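/- Let $K$ be a non-archimedean local field with residue field of $q$ elements and absolute value normalized by $|\pi|=q^{-1}$ for a uniformizer $\pi$; put $|x|=\max_i|x_i|$ on $K^n$. Let $\psi$ be a (unitary) additive character of $K$ that is trivial on the maximal ideal $\mathcal M_K$ and nontrivial on the valuation ring $\mathcal O_K$. A subset $M\subset K^n$ is a *$K$-analytic manifold of dimension $d$* if it is covered by relatively open subsets $U$ such that some projection $p_U:K^n\to K^d$ onto $d$ of the $n$ coordinates maps $U$ bijectively onto an open $U'\subset K^d$ with $K$-analytic inverse $f=(f_1,\dots,f_n):U'\to U$ (that is, locally given by convergent power series). The cover can be chosen such that the $p_U$ are isometries for $|\cdot|$; the *induced measure* $\mu_M$ is the measure on $M$ that corresponds on each such isometric $U$, under $p_U$, to the Haar measure of $K^d$ giving $\mathcal O_K^d$ measure $1$. For an integer $k>0$, $M$ is *of type $\le k$ at $x_0\in M$* if, in such coordinates $f$ around $x_0$, for each nonzero $v\in K^n$ there is $\alpha\in\mathbf N^d$ with $0<|\alpha|\le k$ and $v\cdot(\partial^\alpha f/\partial x^\alpha)(p_U(x_0))\neq 0$, where $|\alpha|=\sum_i\alpha_i$.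 $M$ is *of finite type* if at each $x_0\in M$ it is of type $\le k$ for some $k$; when $\operatorname{char}K=0$ this is equivalent to: for each $x_0 \in M$, no open neighbourhood of $x_0$ in $M$ is contained in an affine hyperplane of $K^n$, and either condition may be used, separately at each point. $M$ is *of type $k$* if $k$ is the least positive integer such that $M$ is of type $\le k$ at each of its points. **Theorem.** Let $M\subset K^n$ be a $K$-analytic manifold of dimension $d$ and of finite type, and let $S\subset M$ be compact and open in $M$. Then $S$ is of type $k$ for some $k>0$. If $\operatorname{char}K=0$ or $\operatorname{char}K>k$ for this $k$, then the Fourier transform $$\widehat\mu_S(y)=\int_{S}\psi(y\cdot x)\,d\mu_S(x),\qquad y\in K^n,$$ satisfies $\lim_{|y|\to\infty}\widehat\mu_S(y)=0$ and, more precisely, there is a constant $c$ such that $$|\widehat\mu_S(y)|\le c\,|y|^{-1/k}\quad\text{for all nonzero } y\in K^n.$$ -/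

import Mathlib

open MeasureTheory Filter Topology Set

section NormalizedNorm

open scoped NormedField Valued

/-- The absolute value of a non-archimedean local field is normalized: a uniformizer has
absolute value `1 / q`, where `q` is the number of elements of the residue field. -/
def IsNormalizedNorm (K : Type*) [NontriviallyNormedField K] [IsUltrametricDist K] : Prop :=
  ∀ ϖ : 𝒪[K], Irreducible ϖ → ‖(ϖ : K)‖ = ((Nat.card 𝓀[K] : ℕ) : ℝ)⁻¹

end NormalizedNorm

namespace NonarchFourier

section Analytic

variable {K : Type*} [NontriviallyNormedField K] {n d : ℕ}

/-- The coordinate projection `K ^ n → K ^ d` onto the `d` coordinates selected by `σ`. -/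
def coordProj (σ : Fin d ↪ Fin n) (x : Fin n → K) : Fin d → K := fun i => x (σ i)

/-- An analytic coordinate system on `M ⊆ K ^ n`: a relatively open `U ⊆ M` that a coordinate
projection maps bijectively onto an open `U' ⊆ K ^ d`, the inverse map `f : U' → U` being
`K`-analytic. (The values of `f` outside `U'` play no role.) -/
structure IsAnalyticChart (M U : Set (Fin n → K)) (σ : Fin d ↪ Fin n)
    (U' : Set (Fin d → K)) (f : (Fin d → K) → (Fin n → K)) : Prop where
  relOpen : ∃ O : Set (Fin n → K), IsOpen O ∧ U = M ∩ O
  isOpen : IsOpen U'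
  bijOn : BijOn (coordProj σ) U U'
  invOn : InvOn f (coordProj σ) U U'
  analytic : AnalyticOnNhd K f U'

/-- `M ⊆ K ^ n` is a `K`-analytic manifold of dimension `d`. -/
def IsAnalyticManifold (d : ℕ) (M : Set (Fin n → K)) : Prop :=
  ∀ x ∈ M, ∃ (U : Set (Fin n → K)) (σ : Fin d ↪ Fin n) (U' : Set (Fin d → K))
    (f : (Fin d → K) → (Fin n → K)), IsAnalyticChart M U σ U' f ∧ x ∈ U

/-- The partial derivative of `f` in the `i`-th variable. -/
noncomputable def partialDeriv (i : Fin d) (f : (Fin d → K) → (Fin n → K)) :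
    (Fin d → K) → (Fin n → K) :=
  fun x => fderiv K f x (Pi.single i 1)

/-- The iterated partial derivative of `f` for the multi-index `α`. -/
noncomputable def multiDeriv (α : Fin d → ℕ) (f : (Fin d → K) → (Fin n → K)) :
    (Fin d → K) → (Fin n → K) :=
  (List.finRange d).foldr (fun i g => (partialDeriv i)^[α i] g) f

/-- `M` is of type at most `k` at `x₀`: in analytic coordinates `f` around `x₀`, for each nonzero
`v` there is a multi-index `α` with `0 < |α| ≤ k` and `v · (∂^α f)(x₀) ≠ 0`. -/
def HasTypeLEAt (d : ℕ) (M : Set (Fin n → K)) (k : ℕ) (x₀ : Fin n → K) : Prop :=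
  ∃ (U : Set (Fin n → K)) (σ : Fin d ↪ Fin n) (U' : Set (Fin d → K))
    (f : (Fin d → K) → (Fin n → K)), IsAnalyticChart M U σ U' f ∧ x₀ ∈ U ∧
    ∀ v : Fin n → K, v ≠ 0 → ∃ α : Fin d → ℕ, 0 < ∑ i, α i ∧ ∑ i, α i ≤ k ∧
      v ⬝ᵥ multiDeriv α f (coordProj σ x₀) ≠ 0

/-- No neighbourhood of `x₀` in `M` is contained in an (affine) hyperplane through `x₀`. -/
def NotLocallyInHyperplaneAt (M : Set (Fin n → K)) (x₀ : Fin n → K) : Prop :=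
  ∀ v : Fin n → K, v ≠ 0 → ∀ O : Set (Fin n → K), IsOpen O → x₀ ∈ O →
    ¬ (M ∩ O ⊆ {x | v ⬝ᵥ x = v ⬝ᵥ x₀})

/-- `M` is of finite type at `x₀`: by the derivative condition for some `k > 0` or, in
characteristic zero, by the hyperplane condition. In characteristic zero the two conditions are
equivalent. In characteristic `p` only the former is meant: the curve `t ↦ (t, t ^ p)` satisfies
the latter, although it has no type, and its Fourier transform does not decay. -/
def IsFiniteTypeAt (d : ℕ) (M : Set (Fin n → K)) (x₀ : Fin n → K) : Prop :=
  (∃ k : ℕ, 0 < k ∧ HasTypeLEAt d M k x₀) ∨ (CharZero K ∧ NotLocallyInHyperplaneAt M x₀)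

/-- `M` is of finite type. -/
def IsFiniteType (d : ℕ) (M : Set (Fin n → K)) : Prop := ∀ x ∈ M, IsFiniteTypeAt d M x

/-- `M` is of type `k`: `k` is the least positive integer such that `M` is of type at most `k`
at each of its points. -/
def IsOfType (d : ℕ) (M : Set (Fin n → K)) (k : ℕ) : Prop :=
  IsLeast {k : ℕ | 0 < k ∧ ∀ x ∈ M, HasTypeLEAt d M k x} k

/-- An analytic coordinate system whose coordinate projection is an isometry. -/
structure IsIsometricChart (M U : Set (Fin n → K)) (σ : Fin d ↪ Fin n)
    (U' : Set (Fin d → K)) (f : (Fin d → K) → (Fin n → K)) : Prop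
    extends IsAnalyticChart M U σ U' f where
  isometry : ∀ x ∈ U, ∀ y ∈ U, dist (coordProj σ x) (coordProj σ y) = dist x y

end Analytic

section InducedMeasure

variable (K : Type*) [NontriviallyNormedField K] [LocallyCompactSpace K]

/-- The unit ball of `K`, as a compact set with nonempty interior. -/
def unitBall : TopologicalSpace.PositiveCompacts K where
  carrier := Metric.closedBall 0 1
  isCompact' := by
    have : ProperSpace K := ProperSpace.of_locallyCompactSpace K
    exact isCompact_closedBall 0 1
  interior_nonempty' :=
    ⟨0, interior_mono Metric.ball_subset_closedBall
      (by rw [Metric.isOpen_ball.interior_eq]; exact Metric.mem_ball_self one_pos)⟩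

variable [MeasurableSpace K] [BorelSpace K]

/-- The Haar measure on `K ^ d` for which the `d`-th power of the unit ball has measure one. -/
noncomputable def haar (d : ℕ) : Measure (Fin d → K) :=
  Measure.pi fun _ => Measure.addHaarMeasure (unitBall K)

variable {K} {n : ℕ}

/-- The induced measure on a `K`-analytic manifold `M` of dimension `d`, as a measure on `K ^ n`.
On each isometric coordinate patch `U ≃ U'` it is the Haar measure of `U' ⊆ K ^ d` transported to
`U`; these measures agree on overlaps, and the least measure above all of them glues them
together. -/
noncomputable def inducedMeasure (d : ℕ) (M : Set (Fin n → K)) : Measure (Fin n → K) :=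
  ⨆ (U : Set (Fin n → K)) (σ : Fin d ↪ Fin n) (U' : Set (Fin d → K))
    (f : (Fin d → K) → (Fin n → K)) (_ : IsIsometricChart M U σ U' f),
    Measure.map f ((haar K d).restrict U')

/-- The Fourier transform `y ↦ ∫_S ψ(y · x) dμ_S(x)` of the induced measure on `S`. -/
noncomputable def fourierInduced (ψ : AddChar K Circle) (d : ℕ) (S : Set (Fin n → K))
    (y : Fin n → K) : ℂ :=
  ∫ x in S, (ψ (y ⬝ᵥ x) : ℂ) ∂(inducedMeasure d S)

end InducedMeasure

end NonarchFourier

namespace NonarchFourier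

/-! The core is a van der Corput estimate over `K` (`exists_norm_integral_addChar_eval_le`): if the
coefficient a_j of a polynomial P, 1 ≤ j ≤ k, dominates all higher ones by a fixed factor, then the
integral of ψ ∘ P over the unit ball is O(|a_j|^(-1/j)), uniformly in the degree and in the lower
coefficients. For j = 1, averaging over short segments makes the phase affine with slope of norm one
up to the maximal ideal, and ψ then integrates to zero. To pass from m to m + 1, move the origin to
the point where the m-th Hasse derivative of P is smallest. Since m + 1 ≠ 0 in `K`, this derivative
is at least |m + 1| |a_(m+1)| |x| at x. The estimate of order m then applies on short segments
inside the annuli around the origin. These are summed down to radius about |a_(m+1)|^(-1/(m+1)), and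
the remaining disc is estimated by its measure. Only here is the restriction on the characteristic
needed. As ψ does not see the maximal ideal, power series may be truncated to polynomials.

On the manifold, type ≤ k says that for each direction v some homogeneous term of v · f of degree m
between 1 and k is nonzero, hence nonzero along some line. By continuity this persists for nearby
points and directions. Averaging over short segments along the line, together with compactness of
the unit sphere of directions, gives decay |y|^(-1/k) over small balls (`exists_decay_near_point`).

Two transfers link this to the induced measure. Taking a maximal minor of the Jacobian of largest
norm produces isometric charts, and the type condition survives the change of chart because it
amounts to an order of vanishing. Changes of isometric chart preserve Haar measure, so the induced
measure is Haar measure in such charts (`inducedMeasure_restrict`). Finally, a compact S is a finite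
disjoint union of small balls.

A finite k exists because the type condition is open and S is compact. In characteristic zero the
hyperplane condition gives a finite order at each point, since a decreasing chain of subspaces of
K^n stabilizes. -/

theorem norm_sub_le_max_norm {E : Type*} [SeminormedAddCommGroup E] [IsUltrametricDist E]
    (x y : E) : ‖x - y‖ ≤ max ‖x‖ ‖y‖ := by
  rw [sub_eq_add_neg]
  exact (IsUltrametricDist.norm_add_le_max _ _).trans_eq (by rw [norm_neg])

/-! ### Uniformizers and the residue field -/

section LocalField

open scoped NormedField Valued

variable {K : Type*} [NontriviallyNormedField K] [IsUltrametricDist K] [LocallyCompactSpace K]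

/-- For a normalized absolute value, a uniformizer together with a system of representatives of
the residue field. -/
theorem exists_uniformizer_representatives (hK : IsNormalizedNorm K) :
    ∃ (ϖ : K) (q : ℕ) (t : Fin q → K), 0 < ‖ϖ‖ ∧ ‖ϖ‖ < 1 ∧ ‖ϖ‖ = (q : ℝ)⁻¹ ∧
      (∀ i, ‖t i‖ ≤ 1) ∧ (∀ i j, i ≠ j → ‖t i - t j‖ = 1) ∧
      ∀ x : K, ‖x‖ ≤ 1 → ∃ i, ‖x - t i‖ ≤ ‖ϖ‖ := by
  have : ProperSpace K := ProperSpace.of_locallyCompactSpace K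
  have hO : CompactSpace 𝒪[K] := by
    have : ((𝒪[K] : Subring K) : Set K) = Metric.closedBall 0 1 := by
      ext x; simp [Valued.integer.mem_iff]
    exact isCompact_iff_compactSpace.mp (this ▸ isCompact_closedBall (0 : K) 1)
  have hnt : (Valued.v : Valuation K NNReal).IsNontrivial := by
    rw [Valuation.isNontrivial_iff_exists_lt_one]
    obtain ⟨x, hx, hx'⟩ := NormedField.exists_norm_lt_one K
    exact ⟨x, norm_pos_iff.mp hx, hx'⟩
  have hdvr : IsDiscreteValuationRing 𝒪[K] := Valued.integer.isDiscreteValuationRing_of_compactSpace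
  obtain ⟨ϖ, hϖ⟩ := IsDiscreteValuationRing.exists_irreducible 𝒪[K]
  have hn := hK ϖ hϖ
  have hpos : 0 < ‖(ϖ : K)‖ := Valued.integer.norm_irreducible_pos hϖ
  have hlt : ‖(ϖ : K)‖ < 1 := Valued.integer.norm_irreducible_lt_one hϖ
  -- `Nat.card` of an infinite type is 0, so an infinite residue field would force `‖ϖ‖ = 0`.
  have hfin : Finite 𝓀[K] := by
    by_contra h
    rw [not_finite_iff_infinite] at h
    rw [Nat.card_eq_zero_of_infinite] at hn
    simp at hn
    simp [hn] at hpos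
  have hmem : ∀ z : 𝒪[K], IsLocalRing.residue 𝒪[K] z = 0 ↔ ‖(z : K)‖ ≤ ‖(ϖ : K)‖ := by
    intro z
    rw [IsLocalRing.residue_eq_zero_iff]
    have := hϖ.maximalIdeal_eq_closedBall
    rw [← SetLike.mem_coe, this, mem_closedBall_zero_iff]; rfl
  obtain ⟨e⟩ := Finite.equivFin 𝓀[K] |> Nonempty.intro
  let t : Fin (Nat.card 𝓀[K]) → 𝒪[K] := fun i => (IsLocalRing.residue_surjective (e.symm i)).choose
  have ht : ∀ i, IsLocalRing.residue 𝒪[K] (t i) = e.symm i :=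
    fun i => (IsLocalRing.residue_surjective (e.symm i)).choose_spec
  refine ⟨ϖ, Nat.card 𝓀[K], fun i => t i, hpos, hlt, hn, fun i => Valued.integer.norm_le_one (t i),
    ?_, ?_⟩
  · intro i j hij
    have h1 : IsUnit (t i - t j) := by
      by_contra h
      have : IsLocalRing.residue 𝒪[K] (t i - t j) = 0 := by
        rw [IsLocalRing.residue_eq_zero_iff]; exact h
      rw [map_sub, ht, ht, sub_eq_zero] at this
      exact hij (e.symm.injective this)
    exact Valued.integer.isUnit_iff_norm_eq_one.mp h1
  · intro x hx
    refine ⟨e (IsLocalRing.residue 𝒪[K] ⟨x, Valued.integer.mem_iff.mpr hx⟩), ?_⟩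
    have := (hmem (⟨x, Valued.integer.mem_iff.mpr hx⟩ -
      t (e (IsLocalRing.residue 𝒪[K] ⟨x, Valued.integer.mem_iff.mpr hx⟩)))).mp
      (by rw [map_sub, ht, Equiv.symm_apply_apply, sub_self])
    exact this

end LocalField

/-! ### Haar measure of balls -/

section HaarBall

variable {K : Type*} [NontriviallyNormedField K] [IsUltrametricDist K] [LocallyCompactSpace K]
  [MeasurableSpace K] [BorelSpace K]

theorem addHaarMeasure_closedBall_one :
    Measure.addHaarMeasure (unitBall K) (Metric.closedBall 0 1) = 1 :=
  Measure.addHaarMeasure_self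

/-- The measure of a ball is its radius. -/
theorem exists_addHaarMeasure_closedBall_pow (hK : IsNormalizedNorm K) :
    ∃ ϖ : K, 0 < ‖ϖ‖ ∧ ‖ϖ‖ < 1 ∧ ∀ m : ℕ,
      Measure.addHaarMeasure (unitBall K) (Metric.closedBall 0 (‖ϖ‖ ^ m)) =
        ENNReal.ofReal (‖ϖ‖ ^ m) := by
  obtain ⟨ϖ, q, t, hpos, hlt, hq, ht1, ht, htx⟩ := exists_uniformizer_representatives hK
  refine ⟨ϖ, hpos, hlt, fun m => ?_⟩
  have hϖ0 : ϖ ≠ 0 := norm_pos_iff.mp hpos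
  have hq0 : (q : ℝ) ≠ 0 := by
    rintro h; rw [hq, h] at hpos; simp at hpos
  induction m with
  | zero => simpa using addHaarMeasure_closedBall_one
  | succ m ih =>
    set μ := Measure.addHaarMeasure (unitBall K)
    have hU : Metric.closedBall (0 : K) (‖ϖ‖ ^ m) =
        ⋃ i, (fun x => ϖ ^ m * t i + x) '' Metric.closedBall (0 : K) (‖ϖ‖ ^ (m + 1)) := by
      ext x
      simp only [mem_closedBall_zero_iff, mem_iUnion, mem_image]
      constructor
      · intro hx
        obtain ⟨i, hi⟩ := htx (x / ϖ ^ m) (by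
          rw [norm_div, norm_pow]; exact div_le_one_of_le₀ hx (by positivity))
        refine ⟨i, x - ϖ ^ m * t i, ?_, by ring⟩
        have : x - ϖ ^ m * t i = ϖ ^ m * (x / ϖ ^ m - t i) := by field_simp
        rw [this, norm_mul, norm_pow, pow_succ]
        gcongr
      · rintro ⟨i, y, hy, rfl⟩
        refine (IsUltrametricDist.norm_add_le_max _ _).trans (max_le ?_ (hy.trans ?_))
        · rw [norm_mul, norm_pow]
          exact mul_le_of_le_one_right (by positivity) (ht1 i)
        · exact pow_le_pow_of_le_one hpos.le hlt.le (Nat.le_succ m)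
    have hd : Pairwise (Function.onFun Disjoint
        fun i => (fun x => ϖ ^ m * t i + x) '' Metric.closedBall (0 : K) (‖ϖ‖ ^ (m + 1))) := by
      intro i j hij
      rw [Function.onFun, Set.disjoint_left]
      rintro _ ⟨x, hx, rfl⟩ ⟨y, hy, hxy⟩
      rw [mem_closedBall_zero_iff] at hx hy
      have h1 : ϖ ^ m * (t i - t j) = y - x := by linear_combination -hxy
      have h2 : ‖y - x‖ ≤ ‖ϖ‖ ^ (m + 1) :=
        (norm_sub_le_max_norm _ _).trans (max_le hy hx)
      rw [← h1, norm_mul, ht i j hij, norm_pow, mul_one] at h2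
      exact absurd h2 (not_le.mpr (pow_lt_pow_right_of_lt_one₀ hpos hlt (Nat.lt_succ_self m)))
    have hm : μ (Metric.closedBall (0 : K) (‖ϖ‖ ^ m)) =
        q * μ (Metric.closedBall (0 : K) (‖ϖ‖ ^ (m + 1))) := by
      rw [hU, measure_iUnion hd]
      · simp only [image_add_left, measure_preimage_add]; simp
      · intro i
        rw [image_add_left]
        exact measurableSet_closedBall.preimage (measurable_const_add _)
    rw [ih] at hm
    have hqe : (q : ENNReal) ≠ 0 := by exact_mod_cast hq0
    rw [eq_comm, ← ENNReal.eq_div_iff hqe (ENNReal.natCast_ne_top q)] at hm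
    rw [hm, pow_succ, hq, ENNReal.ofReal_mul (by positivity), ENNReal.ofReal_inv_of_pos (by positivity),
      ENNReal.ofReal_natCast, div_eq_mul_inv]

end HaarBall

/-! ### Averaging over translates and cancellation of characters -/

section Averaging

variable {K : Type*} [NontriviallyNormedField K] [IsUltrametricDist K] [LocallyCompactSpace K]
  [MeasurableSpace K] [BorelSpace K]

/-- Averaging over translates: the integral over a compact set which is stable under translation
by `u • w`, `‖u‖ ≤ 1`, is bounded by the integrals over the segments `{x + u • w}`. -/
theorem norm_setIntegral_le_of_translates {E : Type*} [NormedAddCommGroup E] [NormedSpace K E]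
    [MeasurableSpace E] [BorelSpace E] [SecondCountableTopology E]
    (μ : Measure E) [μ.IsAddLeftInvariant] [IsFiniteMeasureOnCompacts μ] [SFinite μ]
    {A : Set E} (hA : IsCompact A) (w : E)
    (hAw : ∀ u : K, ‖u‖ ≤ 1 → ∀ x, x ∈ A → x + u • w ∈ A)
    {G : E → ℂ} (hG : ContinuousOn G A) {b : ℝ}
    (hb : ∀ x ∈ A, ‖∫ u in Metric.closedBall (0 : K) 1, G (x + u • w)
      ∂(Measure.addHaarMeasure (unitBall K))‖ ≤ b) :
    ‖∫ x in A, G x ∂μ‖ ≤ b * μ.real A := by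
  have : ProperSpace K := ProperSpace.of_locallyCompactSpace K
  set ν := Measure.addHaarMeasure (unitBall K)
  have hO : IsCompact (Metric.closedBall (0 : K) 1) := isCompact_closedBall 0 1
  have hAm : MeasurableSet A := hA.measurableSet
  have h1 : ∀ u ∈ Metric.closedBall (0 : K) 1, ∫ x in A, G (x + u • w) ∂μ = ∫ x in A, G x ∂μ := by
    intro u hu
    rw [mem_closedBall_zero_iff] at hu
    rw [← integral_indicator hAm, ← integral_indicator hAm,
      ← integral_add_left_eq_self (μ := μ) (fun x => A.indicator G x) (u • w)]
    congr 1
    ext x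
    by_cases hx : x ∈ A
    · rw [indicator_of_mem hx, indicator_of_mem, add_comm]
      rw [add_comm]; exact hAw u hu x hx
    · rw [indicator_of_notMem hx, indicator_of_notMem]
      intro h
      apply hx
      have := hAw (-u) (by simpa using hu) _ h
      simpa [add_comm] using this
  have h2 : ∫ u in Metric.closedBall (0 : K) 1, ∫ x in A, G (x + u • w) ∂μ ∂ν
      = ∫ x in A, G x ∂μ := by
    rw [setIntegral_congr_fun measurableSet_closedBall h1]
    simp [Measure.real, ν, addHaarMeasure_closedBall_one]
  rw [← h2, integral_integral_swap]
  · exact norm_setIntegral_le_of_norm_le_const hA.measure_lt_top hb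
  · rw [Measure.prod_restrict]
    refine ContinuousOn.integrableOn_compact (hO.prod hA) ?_
    refine hG.comp (by fun_prop) ?_
    rintro ⟨u, x⟩ ⟨hu, hx⟩
    exact hAw u (by simpa using hu) x hx

omit [IsUltrametricDist K] [LocallyCompactSpace K] [MeasurableSpace K] [BorelSpace K] in
theorem addChar_add_eq_of_norm_lt_one {ψ : AddChar K Circle} (hψ : ∀ x : K, ‖x‖ < 1 → ψ x = 1)
    (x : K) {y : K} (hy : ‖y‖ < 1) : ψ (x + y) = ψ x := by
  rw [AddChar.map_add_eq_mul, hψ y hy, mul_one]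

omit [IsUltrametricDist K] [LocallyCompactSpace K] [MeasurableSpace K] [BorelSpace K] in
theorem continuous_addChar {ψ : AddChar K Circle} (hψ : ∀ x : K, ‖x‖ < 1 → ψ x = 1) :
    Continuous ψ := by
  refine (IsLocallyConstant.iff_exists_open _).mpr (fun x => ?_) |>.continuous
  refine ⟨Metric.ball x 1, Metric.isOpen_ball, Metric.mem_ball_self one_pos, fun y hy => ?_⟩
  rw [← addChar_add_eq_of_norm_lt_one hψ x (y := y - x) (by rwa [← dist_eq_norm])]
  congr 1; ring

/-- The translation by x / c preserves the unit ball, because |c| ≥ 1, and multiplies the integral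
by ψ x ≠ 1. -/
theorem integral_addChar_mul_eq_zero {ψ : AddChar K Circle}
    (hψ' : ∃ x : K, ‖x‖ ≤ 1 ∧ ψ x ≠ 1) {c : K} (hc : 1 ≤ ‖c‖) :
    ∫ u in Metric.closedBall (0 : K) 1, (ψ (c * u) : ℂ)
      ∂(Measure.addHaarMeasure (unitBall K)) = 0 := by
  set ν := Measure.addHaarMeasure (unitBall K)
  obtain ⟨x, hx, hψx⟩ := hψ'
  have hc0 : c ≠ 0 := norm_pos_iff.mp (one_pos.trans_le hc)
  set z := x / c
  have hz : ‖z‖ ≤ 1 := by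
    rw [norm_div]; exact div_le_one_of_le₀ (hx.trans hc) (norm_nonneg _)
  have hO : MeasurableSet (Metric.closedBall (0 : K) 1) := measurableSet_closedBall
  set I := ∫ u in Metric.closedBall (0 : K) 1, (ψ (c * u) : ℂ) ∂ν
  have h : I = (ψ x : ℂ) * I := by
    simp only [I]
    rw [← integral_const_mul]
    rw [← integral_indicator hO, ← integral_indicator hO, ← integral_add_left_eq_self _ z]
    congr 1
    ext u
    have : z + u ∈ Metric.closedBall (0 : K) 1 ↔ u ∈ Metric.closedBall (0 : K) 1 := by
      rw [mem_closedBall_zero_iff, mem_closedBall_zero_iff]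
      constructor <;> intro h
      · have := (norm_sub_le_max_norm (z + u) z).trans (max_le h hz)
        simpa using this
      · exact (IsUltrametricDist.norm_add_le_max _ _).trans (max_le hz h)
    by_cases hu : u ∈ Metric.closedBall (0 : K) 1
    · rw [indicator_of_mem hu, indicator_of_mem (this.mpr hu), mul_add, AddChar.map_add_eq_mul,
        mul_div_cancel₀ _ hc0]
      simp
    · rw [indicator_of_notMem hu, indicator_of_notMem (mt this.mp hu)]
  have h' : (1 - (ψ x : ℂ)) * I = 0 := by linear_combination h
  rcases mul_eq_zero.mp h' with h | h
  · exact absurd (Circle.ext (by simpa using (sub_eq_zero.mp h).symm)) hψx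
  · exact h

end Averaging

end NonarchFourier

namespace NonarchFourier

/-! ### Recentring polynomials at points of the unit ball -/

section Taylor

open Polynomial

variable {K : Type*} [NontriviallyNormedField K] [IsUltrametricDist K]

omit [IsUltrametricDist K] in
theorem taylor_coeff_eq_sum (P : K[X]) (c : K) (i : ℕ) {N : ℕ} (hN : P.natDegree < N) :
    (taylor c P).coeff i = ∑ l ∈ Finset.range N, (l.choose i : K) * P.coeff l * c ^ (l - i) := by
  rw [taylor_coeff, hasseDeriv_apply, sum_over_range' _ _ N hN, eval_finsetSum]
  · simp
  · simp

theorem norm_choose_mul_le {B : ℝ} {a c : K} (ha : ‖a‖ ≤ B) (hc : ‖c‖ ≤ 1)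
    (l i m : ℕ) : ‖(l.choose i : K) * a * c ^ m‖ ≤ B := by
  rw [norm_mul, norm_mul, norm_pow]
  have h1 : ‖(l.choose i : K)‖ ≤ 1 := IsUltrametricDist.norm_natCast_le_one K _
  calc _ ≤ 1 * ‖a‖ * 1 := by gcongr; exact pow_le_one₀ (norm_nonneg _) hc
    _ ≤ B := by simpa using ha

/-- The i-th coefficient after recentring involves only old coefficients of index ≥ i, with factors
of norm at most one. Bounds on the tail therefore survive, whatever the lower coefficients are. -/
theorem norm_taylor_coeff_le {P : K[X]} {j : ℕ} {B : ℝ} (hB : 0 ≤ B)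
    (hP : ∀ i, j < i → ‖P.coeff i‖ ≤ B) {c : K} (hc : ‖c‖ ≤ 1) {i : ℕ} (hi : j < i) :
    ‖(taylor c P).coeff i‖ ≤ B := by
  rw [taylor_coeff_eq_sum P c i (Nat.lt_succ_self _)]
  refine IsUltrametricDist.norm_sum_le_of_forall_le_of_nonneg hB fun l _ => ?_
  rcases lt_or_ge l i with h | h
  · simpa [Nat.choose_eq_zero_of_lt h] using hB
  · exact norm_choose_mul_le (hP l (hi.trans_le h)) hc _ _ _

/-- Besides the old j-th coefficient only the tail enters. If B is smaller than its norm, recentring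
leaves that norm unchanged. -/
theorem norm_taylor_coeff_sub_le {P : K[X]} {j : ℕ} {B : ℝ} (hB : 0 ≤ B)
    (hP : ∀ i, j < i → ‖P.coeff i‖ ≤ B) {c : K} (hc : ‖c‖ ≤ 1) :
    ‖(taylor c P).coeff j - P.coeff j‖ ≤ B := by
  rw [taylor_coeff_eq_sum P c j (N := P.natDegree + j + 1) (by omega),
    Finset.sum_eq_add_sum_sdiff_singleton_of_mem (i := j) (by simp)]
  simp only [Nat.choose_self, Nat.cast_one, one_mul, Nat.sub_self, pow_zero, mul_one,
    add_sub_cancel_left]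
  refine IsUltrametricDist.norm_sum_le_of_forall_le_of_nonneg hB fun l hl => ?_
  rcases lt_or_ge l j with h | h
  · simpa [Nat.choose_eq_zero_of_lt h] using hB
  · refine norm_choose_mul_le (hP l (lt_of_le_of_ne h ?_)) hc _ _ _
    rintro rfl; simp at hl

/-- The m-th Hasse derivative expanded to first order in c; each remaining term still contains a
factor c. When B < |m + 1| |a_(m+1)| the linear term determines the variation. -/
theorem norm_taylor_coeff_sub_sub_le {P : K[X]} {m : ℕ} {B : ℝ} (hB : 0 ≤ B)
    (hP : ∀ i, m + 1 < i → ‖P.coeff i‖ ≤ B) {c : K} (hc : ‖c‖ ≤ 1) :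
    ‖(taylor c P).coeff m - P.coeff m - (m + 1 : ℕ) * P.coeff (m + 1) * c‖ ≤ B * ‖c‖ := by
  rw [taylor_coeff_eq_sum P c m (N := P.natDegree + m + 2) (by omega),
    Finset.sum_eq_add_sum_sdiff_singleton_of_mem (i := m) (by simp; omega),
    Finset.sum_eq_add_sum_sdiff_singleton_of_mem (i := m + 1) (by simp)]
  simp only [Nat.choose_self, Nat.cast_one, one_mul, Nat.sub_self, pow_zero, mul_one,
    add_sub_cancel_left, Nat.choose_succ_self_right, Nat.add_sub_cancel_left (n := m) (m := 1), pow_one]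
  refine IsUltrametricDist.norm_sum_le_of_forall_le_of_nonneg (by positivity) fun l hl => ?_
  simp only [Finset.mem_sdiff, Finset.mem_range, Finset.mem_singleton] at hl
  rcases lt_or_ge l m with h | h
  · simpa [Nat.choose_eq_zero_of_lt h] using by positivity
  · have h2 : l - m = (l - m - 1) + 1 := by omega
    rw [h2, pow_succ, ← mul_assoc, norm_mul _ c]
    gcongr
    exact norm_choose_mul_le (hP l (by omega)) hc _ _ _

omit [IsUltrametricDist K] in
theorem eval_add_mul_eq (P : K[X]) (x s u : K) :
    P.eval (x + u * s) = ((taylor x P).comp (C s * X)).eval u := by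
  rw [eval_comp, taylor_eval]
  congr 1
  simp; ring

end Taylor

/-! ### Van der Corput's lemma: the linear case -/

section Oscillatory

open Polynomial

variable {K : Type*} [NontriviallyNormedField K] [IsUltrametricDist K] [LocallyCompactSpace K]
  [MeasurableSpace K] [BorelSpace K] {ψ : AddChar K Circle}

omit [IsUltrametricDist K] [LocallyCompactSpace K] [MeasurableSpace K] [BorelSpace K] in
theorem norm_setIntegral_addChar_le {E : Type*} [MeasurableSpace E] {μ : Measure E} {A : Set E}
    (hA : μ A < ⊤) (F : E → K) : ‖∫ x in A, (ψ (F x) : ℂ) ∂μ‖ ≤ μ.real A := by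
  refine (norm_setIntegral_le_of_norm_le_const (C := 1) hA fun x _ => ?_).trans_eq (one_mul _)
  exact (Circle.norm_coe _).le

theorem norm_integral_unitBall_addChar_le_one (F : K → K) :
    ‖∫ u in Metric.closedBall (0 : K) 1, (ψ (F u) : ℂ)
      ∂(Measure.addHaarMeasure (unitBall K))‖ ≤ 1 := by
  refine (norm_setIntegral_addChar_le ?_ F).trans_eq ?_
  · rw [addHaarMeasure_closedBall_one]; simp
  · rw [Measure.real, addHaarMeasure_closedBall_one]; simp

/-- The oscillatory integral vanishes if the phase is, up to the maximal ideal, a nonconstant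
affine function. -/
theorem integral_addChar_eval_eq_zero (hψ : ∀ x : K, ‖x‖ < 1 → ψ x = 1)
    (hψ' : ∃ x : K, ‖x‖ ≤ 1 ∧ ψ x ≠ 1) {Q : K[X]} (h1 : 1 ≤ ‖Q.coeff 1‖)
    (h2 : ∀ i, 1 < i → ‖Q.coeff i‖ < 1) :
    ∫ u in Metric.closedBall (0 : K) 1, (ψ (Q.eval u) : ℂ)
      ∂(Measure.addHaarMeasure (unitBall K)) = 0 := by
  have key : ∀ u ∈ Metric.closedBall (0 : K) 1, (ψ (Q.eval u) : ℂ)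
      = (ψ (Q.coeff 0) : ℂ) * (ψ (Q.coeff 1 * u) : ℂ) := by
    intro u hu
    rw [mem_closedBall_zero_iff] at hu
    rw [eval_eq_sum_range' (n := Q.natDegree + 2) (by omega), Finset.sum_range_succ',
      Finset.sum_range_succ']
    have : ‖∑ i ∈ Finset.range Q.natDegree, Q.coeff (i + 1 + 1) * u ^ (i + 1 + 1)‖ < 1 := by
      rcases (Finset.range Q.natDegree).eq_empty_or_nonempty with he | he
      · rw [he]; simp
      refine IsUltrametricDist.exists_norm_finsetSum_le_of_nonempty he _ |>.elim fun i hi =>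
        hi.2.trans_lt ?_
      rw [norm_mul, norm_pow]
      refine (mul_le_of_le_one_right (norm_nonneg _) (pow_le_one₀ (norm_nonneg _) hu)).trans_lt ?_
      exact h2 _ (by omega)
    rw [add_assoc, add_comm, addChar_add_eq_of_norm_lt_one hψ _ this, AddChar.map_add_eq_mul]
    simp [mul_comm]
  rw [setIntegral_congr_fun measurableSet_closedBall key, integral_const_mul,
    integral_addChar_mul_eq_zero hψ' h1, mul_zero]

/-- One domination factor ε that serves every stage of the induction on the order. -/
theorem exists_pos_lt_norm_natCast (K : Type*) [NontriviallyNormedField K] (k : ℕ)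
    (hk : ∀ i : ℕ, 1 ≤ i → i ≤ k → (i : K) ≠ 0) :
    ∃ ε : ℝ, 0 < ε ∧ ε < 1 ∧ ∀ i : ℕ, 1 ≤ i → i ≤ k → ε < ‖(i : K)‖ := by
  have h : ∀ᶠ ε : ℝ in 𝓝[>] 0, ∀ i ∈ Finset.Icc 1 k, ε < ‖(i : K)‖ := by
    rw [Filter.eventually_all_finset]
    intro i hi
    rw [Finset.mem_Icc] at hi
    exact nhdsWithin_le_nhds (eventually_lt_nhds (norm_pos_iff.mpr (hk i hi.1 hi.2)))
  obtain ⟨ε, h1, h2, h3⟩ := (h.and ((eventually_mem_nhdsWithin (a := (0 : ℝ)) (s := Ioi 0)).and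
    (nhdsWithin_le_nhds (eventually_lt_nhds (one_pos (α := ℝ)))))).exists
  exact ⟨ε, h2, h3, fun i hi hi' => h1 i (Finset.mem_Icc.mpr ⟨hi, hi'⟩)⟩

/-- On the segments x + u / a₁ the phase has slope of norm one and higher coefficients of norm < 1,
so each integral over a segment vanishes. Hence the whole integral is zero when |a₁| > 1; otherwise
the trivial bound suffices. -/
theorem norm_integral_addChar_eval_le_of_linear (hψ : ∀ x : K, ‖x‖ < 1 → ψ x = 1)
    (hψ' : ∃ x : K, ‖x‖ ≤ 1 ∧ ψ x ≠ 1) {ε : ℝ} (hε1 : ε < 1) {P : K[X]}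
    (hP0 : P.coeff 1 ≠ 0) (hP : ∀ i, 1 < i → ‖P.coeff i‖ ≤ ε * ‖P.coeff 1‖) :
    ‖∫ u in Metric.closedBall (0 : K) 1, (ψ (P.eval u) : ℂ)
      ∂(Measure.addHaarMeasure (unitBall K))‖ ≤ ‖P.coeff 1‖⁻¹ := by
  have : ProperSpace K := ProperSpace.of_locallyCompactSpace K
  have hA : 0 < ‖P.coeff 1‖ := norm_pos_iff.mpr hP0
  rcases le_or_gt ‖P.coeff 1‖ 1 with h1 | h1
  · exact (norm_integral_unitBall_addChar_le_one _).trans (one_le_inv₀ hA |>.mpr h1)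
  set A := ‖P.coeff 1‖ with hAdef
  have hεA : 0 ≤ ε * A := (norm_nonneg _).trans (hP 2 (by norm_num))
  have hs : ‖(P.coeff 1)⁻¹‖ ≤ 1 := by rw [norm_inv]; exact inv_le_one_of_one_le₀ h1.le
  refine (norm_setIntegral_le_of_translates (K := K) (Measure.addHaarMeasure (unitBall K))
    (isCompact_closedBall (0 : K) 1) (P.coeff 1)⁻¹ ?_ ?_ (b := 0) ?_).trans ?_
  · intro u hu x hx
    rw [mem_closedBall_zero_iff] at hx ⊢
    refine (IsUltrametricDist.norm_add_le_max _ _).trans (max_le hx ?_)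
    rw [smul_eq_mul, norm_mul]
    exact mul_le_one₀ hu (norm_nonneg _) hs
  · exact (continuous_subtype_val.comp ((continuous_addChar hψ).comp P.continuous)).continuousOn
  · intro x hx
    rw [mem_closedBall_zero_iff] at hx
    simp only [smul_eq_mul, eval_add_mul_eq]
    rw [integral_addChar_eval_eq_zero hψ hψ', norm_zero]
    · rw [comp_C_mul_X_coeff, norm_mul, pow_one, norm_inv]
      have h2 : ‖(taylor x P).coeff 1 - P.coeff 1‖ < ‖P.coeff 1‖ :=
        (norm_taylor_coeff_sub_le hεA hP hx).trans_lt (mul_lt_of_lt_one_left hA hε1)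
      have h3 : ‖(taylor x P).coeff 1‖ = ‖P.coeff 1‖ := by
        have := IsUltrametricDist.norm_add_eq_max_of_norm_ne_norm h2.ne
        rwa [sub_add_cancel, max_eq_right h2.le] at this
      rw [h3, ← hAdef, mul_inv_cancel₀ hA.ne']
    · intro i hi
      rw [comp_C_mul_X_coeff, norm_mul, norm_pow, norm_inv, ← hAdef]
      calc ‖(taylor x P).coeff i‖ * A⁻¹ ^ i ≤ (ε * A) * A⁻¹ := by
            gcongr
            · exact norm_taylor_coeff_le hεA hP hx hi
            · exact pow_le_of_le_one (by positivity) (inv_le_one_of_one_le₀ h1.le) (by omega)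
        _ = ε := by field_simp
        _ < 1 := hε1
  · simpa using hA.le

end Oscillatory

end NonarchFourier

namespace NonarchFourier

/-! ### Van der Corput's lemma: the induction on the order -/

section OscillatoryStep

open Polynomial

/-- The contributions of the annuli form a geometric sum of ratio ρ^(-1/m) > 1, comparable to its
last term. Stopping at radius about δ = A^(-1/(m+1)) balances it against the remaining disc, since
A^(-1/m) δ^(-1/m) = δ. -/
theorem geometric_rpow_bound {A ρ : ℝ} (hA : 1 < A) (hρ : 0 < ρ) (hρ1 : ρ < 1) {m : ℕ}
    (hm : 1 ≤ m) :
    ∃ N : ℕ, ρ ^ N ≤ A ^ (-(1 : ℝ) / (m + 1 : ℕ)) ∧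
      ∑ i ∈ Finset.range N, A ^ (-(1 : ℝ) / m) * (ρ ^ (-(1 : ℝ) / m)) ^ i ≤
        ρ ^ (-(1 : ℝ) / m) / (ρ ^ (-(1 : ℝ) / m) - 1) * A ^ (-(1 : ℝ) / (m + 1 : ℕ)) := by
  have hA0 : 0 < A := one_pos.trans hA
  have hm0 : (0 : ℝ) < m := by exact_mod_cast hm
  have hδ : 0 < A ^ (-(1 : ℝ) / (m + 1 : ℕ)) := by positivity
  have hδ1 : A ^ (-(1 : ℝ) / (m + 1 : ℕ)) ≤ 1 := by
    refine Real.rpow_le_one_of_one_le_of_nonpos hA.le ?_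
    rw [neg_div]; exact neg_nonpos.mpr (by positivity)
  obtain ⟨n, hn1, hn2⟩ := exists_nat_pow_near_of_lt_one hδ hδ1 hρ hρ1
  refine ⟨n + 1, hn1.le, ?_⟩
  set β := ρ ^ (-(1 : ℝ) / m) with hβ
  have hβ1 : 1 < β := by
    refine Real.one_lt_rpow_of_pos_of_lt_one_of_neg hρ hρ1 ?_
    rw [neg_div]; exact neg_neg_of_pos (by positivity)
  rw [← Finset.mul_sum, geom_sum_eq hβ1.ne']
  have h1 : β ^ n ≤ (A ^ (-(1 : ℝ) / (m + 1 : ℕ))) ^ (-(1 : ℝ) / m) := by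
    rw [hβ, ← Real.rpow_natCast, ← Real.rpow_mul hρ.le, mul_comm, Real.rpow_mul hρ.le,
      Real.rpow_natCast]
    refine Real.rpow_le_rpow_of_nonpos hδ hn2 ?_
    rw [neg_div]; exact neg_nonpos.mpr (by positivity)
  have h2 : A ^ (-(1 : ℝ) / m) * (A ^ (-(1 : ℝ) / (m + 1 : ℕ))) ^ (-(1 : ℝ) / m) =
      A ^ (-(1 : ℝ) / (m + 1 : ℕ)) := by
    rw [← Real.rpow_mul hA0.le, ← Real.rpow_add hA0]
    congr 1
    push_cast
    field_simp
    ring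
  have hβp : 0 < β - 1 := by linarith
  calc A ^ (-(1 : ℝ) / m) * ((β ^ (n + 1) - 1) / (β - 1))
      ≤ A ^ (-(1 : ℝ) / m) * ((β * (A ^ (-(1 : ℝ) / (m + 1 : ℕ))) ^ (-(1 : ℝ) / m)) / (β - 1)) := by
        gcongr
        rw [pow_succ, mul_comm]
        nlinarith [mul_le_mul_of_nonneg_left h1 (zero_le_one.trans hβ1.le)]
    _ = β / (β - 1) * (A ^ (-(1 : ℝ) / m) *
          (A ^ (-(1 : ℝ) / (m + 1 : ℕ))) ^ (-(1 : ℝ) / m)) := by ring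
    _ = _ := by rw [h2]

variable {K : Type*} [NontriviallyNormedField K] [IsUltrametricDist K] [LocallyCompactSpace K]
  [MeasurableSpace K] [BorelSpace K] {ψ : AddChar K Circle}

theorem norm_setIntegral_le_add_sum_sdiff {E : Type*} [MeasurableSpace E] {μ : Measure E}
    {B : ℕ → Set E} (hB : Antitone B) (hm : ∀ i, MeasurableSet (B i)) {G : E → ℂ}
    (hG : IntegrableOn G (B 0) μ) (N : ℕ) :
    ‖∫ x in B 0, G x ∂μ‖ ≤ ‖∫ x in B N, G x ∂μ‖ +
      ∑ i ∈ Finset.range N, ‖∫ x in B i \ B (i + 1), G x ∂μ‖ := by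
  induction N with
  | zero => simp
  | succ N ih =>
    refine ih.trans ?_
    rw [Finset.sum_range_succ]
    have h := integral_inter_add_sdiff (μ := μ) (f := G) (s := B N) (hm (N + 1))
      (hG.mono_set (hB (Nat.zero_le N)))
    rw [inter_eq_right.mpr (hB (Nat.le_succ N))] at h
    rw [← h]
    linarith [norm_add_le (∫ x in B (N + 1), G x ∂μ) (∫ x in B N \ B (N + 1), G x ∂μ)]

/-- The induction step from order `m` to order `m + 1`, when the origin is a minimum of the
absolute value of the `m`-th Hasse derivative. -/
theorem norm_integral_addChar_eval_le_of_min {ϖ : K} (hϖ0 : 0 < ‖ϖ‖) (hϖ1 : ‖ϖ‖ < 1)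
    (hϖ : ∀ i : ℕ, Measure.addHaarMeasure (unitBall K) (Metric.closedBall 0 (‖ϖ‖ ^ i)) =
        ENNReal.ofReal (‖ϖ‖ ^ i))
    (hψ : ∀ x : K, ‖x‖ < 1 → ψ x = 1) {ε : ℝ} (hε0 : 0 < ε) (hε1 : ε < 1)
    {m : ℕ} (hm : 1 ≤ m) (hmε : ε < ‖((m + 1 : ℕ) : K)‖) {C : ℝ} (hC : 0 ≤ C)
    (ih : ∀ P : K[X], P.coeff m ≠ 0 → (∀ i, m < i → ‖P.coeff i‖ ≤ ε * ‖P.coeff m‖) →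
      ‖∫ u in Metric.closedBall (0 : K) 1, (ψ (P.eval u) : ℂ)
      ∂(Measure.addHaarMeasure (unitBall K))‖ ≤ C * ‖P.coeff m‖ ^ (-(1 : ℝ) / m))
    {η : K} (hη0 : 0 < ‖η‖) (hη : ‖η‖ ≤ ε * ‖((m + 1 : ℕ) : K)‖)
    {P : K[X]} (hP0 : 1 < ‖P.coeff (m + 1)‖)
    (hP : ∀ i, m + 1 < i → ‖P.coeff i‖ ≤ ε * ‖P.coeff (m + 1)‖)
    (hmin : ∀ x : K, ‖x‖ ≤ 1 → ‖P.coeff m‖ ≤ ‖(taylor x P).coeff m‖) :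
    ‖∫ u in Metric.closedBall (0 : K) 1, (ψ (P.eval u) : ℂ)
      ∂(Measure.addHaarMeasure (unitBall K))‖ ≤
      (1 + C * (‖((m + 1 : ℕ) : K)‖ * ‖η‖ ^ m) ^ (-(1 : ℝ) / m) * ‖ϖ‖ ^ (-(m + 1 : ℝ) / m) *
        (‖ϖ‖ ^ (-(1 : ℝ) / m) / (‖ϖ‖ ^ (-(1 : ℝ) / m) - 1))) *
        ‖P.coeff (m + 1)‖ ^ (-(1 : ℝ) / (m + 1 : ℕ)) := by
  have : ProperSpace K := ProperSpace.of_locallyCompactSpace K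
  set μ := Measure.addHaarMeasure (unitBall K)
  set A := ‖P.coeff (m + 1)‖ with hAdef
  set ρ := ‖ϖ‖ with hρdef
  set J := ‖((m + 1 : ℕ) : K)‖ with hJdef
  have hA : 0 < A := one_pos.trans hP0
  have hJ : 0 < J := hε0.trans hmε
  have hJ1 : J ≤ 1 := IsUltrametricDist.norm_natCast_le_one K _
  have hm0 : (0 : ℝ) < m := by exact_mod_cast hm
  have hεA : 0 ≤ ε * A := by positivity
  have hη1 : ‖η‖ < 1 := hη.trans_lt (by nlinarith)
  -- As ε < J, the linear term dominates the remainder, so the m-th coefficient changes by exactly J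
  -- A |x| in norm between 0 and x. Its value at 0 is minimal, so the value at x has at least this
  -- norm.
  have hlow : ∀ x : K, ‖x‖ ≤ 1 → J * A * ‖x‖ ≤ ‖(taylor x P).coeff m‖ := by
    intro x hx
    rcases eq_or_ne x 0 with rfl | hx0
    · simp
    have hx0' : 0 < ‖x‖ := norm_pos_iff.mpr hx0
    have h1 := norm_taylor_coeff_sub_sub_le hεA hP hx
    have h2 : ‖((m + 1 : ℕ) : K) * P.coeff (m + 1) * x‖ = J * A * ‖x‖ := by
      rw [norm_mul, norm_mul]
    have h3 : ‖(taylor x P).coeff m - P.coeff m‖ = J * A * ‖x‖ := by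
      have h4 : ‖(taylor x P).coeff m - P.coeff m - (m + 1 : ℕ) * P.coeff (m + 1) * x‖ <
          ‖((m + 1 : ℕ) : K) * P.coeff (m + 1) * x‖ := by
        rw [h2]
        refine h1.trans_lt ?_
        gcongr
      have := IsUltrametricDist.norm_add_eq_max_of_norm_ne_norm h4.ne
      rwa [sub_add_cancel, max_eq_right h4.le, h2] at this
    rw [← h3]
    exact (norm_sub_le_max_norm _ _).trans (max_le le_rfl (hmin x hx))
  have hball : ∀ i : ℕ, μ.real (Metric.closedBall 0 (ρ ^ i)) = ρ ^ i := by
    intro i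
    rw [Measure.real, hϖ i, ENNReal.toReal_ofReal (by positivity)]
  have hcont : Continuous fun u : K => (ψ (P.eval u) : ℂ) :=
    continuous_subtype_val.comp ((continuous_addChar hψ).comp P.continuous)
  have hann : ∀ i : ℕ, ‖∫ u in Metric.closedBall (0 : K) (ρ ^ i) \ Metric.closedBall 0 (ρ ^ (i + 1)),
      (ψ (P.eval u) : ℂ) ∂μ‖ ≤ C * (J * ‖η‖ ^ m) ^ (-(1 : ℝ) / m) * ρ ^ (-(m + 1 : ℝ) / m) *
        (A ^ (-(1 : ℝ) / m) * (ρ ^ (-(1 : ℝ) / m)) ^ i) := by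
    intro i
    have hρi : 0 < ρ ^ (i + 1) := by positivity
    -- Segments of length |η| ρ^(i+1) stay inside the annulus. The factor η, with |η| ≤ ε J, makes
    -- the m-th coefficient dominate the higher ones after rescaling.
    have hs : ‖η * ϖ ^ (i + 1)‖ = ‖η‖ * ρ ^ (i + 1) := by rw [norm_mul, norm_pow]
    have hs1 : ‖η * ϖ ^ (i + 1)‖ ≤ 1 := by
      rw [hs]; exact mul_le_one₀ hη1.le (by positivity) (pow_le_one₀ hϖ0.le hϖ1.le)
    have hs0 : 0 < ‖η * ϖ ^ (i + 1)‖ := by rw [hs]; positivity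
    have hcomp : IsCompact (Metric.closedBall (0 : K) (ρ ^ i) \ Metric.closedBall 0 (ρ ^ (i + 1))) :=
      (isCompact_closedBall _ _).diff (IsUltrametricDist.isOpen_closedBall _ hρi.ne')
    refine (norm_setIntegral_le_of_translates (K := K) μ hcomp (η * ϖ ^ (i + 1)) ?_
      hcont.continuousOn (b := C * (J * A * ρ ^ (i + 1) * (‖η‖ * ρ ^ (i + 1)) ^ m) ^ (-(1 : ℝ) / m))
      ?_).trans ?_
    · intro u hu x ⟨hx1, hx2⟩
      rw [mem_closedBall_zero_iff] at hx1 hx2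
      rw [not_le] at hx2
      have h1 : ‖u • (η * ϖ ^ (i + 1))‖ < ‖x‖ := by
        rw [smul_eq_mul, norm_mul, hs]
        calc ‖u‖ * (‖η‖ * ρ ^ (i + 1)) ≤ 1 * (1 * ρ ^ (i + 1)) := by gcongr
          _ < ‖x‖ := by simpa using hx2
      have h2 : ‖x + u • (η * ϖ ^ (i + 1))‖ = ‖x‖ := by
        rw [IsUltrametricDist.norm_add_eq_max_of_norm_ne_norm h1.ne', max_eq_left h1.le]
      refine ⟨?_, ?_⟩
      · rwa [mem_closedBall_zero_iff, h2]
      · rw [mem_closedBall_zero_iff, h2]; exact not_le.mpr hx2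
    · rintro x ⟨hx1, hx2⟩
      rw [mem_closedBall_zero_iff] at hx1 hx2
      rw [not_le] at hx2
      have hx : ‖x‖ ≤ 1 := hx1.trans (pow_le_one₀ hϖ0.le hϖ1.le)
      simp only [smul_eq_mul, eval_add_mul_eq]
      have hQm : J * A * ρ ^ (i + 1) * (‖η‖ * ρ ^ (i + 1)) ^ m ≤
          ‖((taylor x P).comp (Polynomial.C (η * ϖ ^ (i + 1)) * X)).coeff m‖ := by
        rw [comp_C_mul_X_coeff, norm_mul, norm_pow, hs]
        gcongr
        refine le_trans ?_ (hlow x hx)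
        gcongr
      have hQm0 : 0 < J * A * ρ ^ (i + 1) * (‖η‖ * ρ ^ (i + 1)) ^ m := by positivity
      refine (ih _ (norm_pos_iff.mp (hQm0.trans_le hQm)) ?_).trans ?_
      · intro l hl
        refine le_trans ?_ (mul_le_mul_of_nonneg_left hQm hε0.le)
        rw [comp_C_mul_X_coeff, norm_mul, norm_pow]
        have h1 : ‖(taylor x P).coeff l‖ ≤ A := by
          rcases eq_or_lt_of_le (Nat.succ_le_of_lt hl) with h | h
          · subst h
            have h2 := norm_taylor_coeff_sub_le hεA hP hx
            have h3 := IsUltrametricDist.norm_add_le_max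
              ((taylor x P).coeff (m + 1) - P.coeff (m + 1)) (P.coeff (m + 1))
            rw [sub_add_cancel] at h3
            exact h3.trans (max_le (h2.trans (by nlinarith)) le_rfl)
          · exact (norm_taylor_coeff_le hεA hP hx h).trans (by nlinarith)
        calc ‖(taylor x P).coeff l‖ * ‖η * ϖ ^ (i + 1)‖ ^ l
            ≤ A * ‖η * ϖ ^ (i + 1)‖ ^ (m + 1) := by
              gcongr ?_ * ?_
              exact pow_le_pow_of_le_one hs0.le hs1 hl
          _ = A * (‖η‖ * ρ ^ (i + 1)) * (‖η‖ * ρ ^ (i + 1)) ^ m := by rw [hs, pow_succ]; ring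
          _ ≤ A * (ε * J * ρ ^ (i + 1)) * (‖η‖ * ρ ^ (i + 1)) ^ m := by gcongr
          _ = _ := by ring
      · gcongr C * ?_
        refine Real.rpow_le_rpow_of_nonpos hQm0 hQm ?_
        rw [neg_div]; exact neg_nonpos.mpr (by positivity)
    · have hmeas : μ.real (Metric.closedBall (0 : K) (ρ ^ i) \ Metric.closedBall 0 (ρ ^ (i + 1))) ≤
          ρ ^ i := by
        refine le_of_le_of_eq ?_ (hball i)
        exact measureReal_mono sdiff_subset (by rw [hϖ]; exact ENNReal.ofReal_ne_top)
      -- The exponent of ρ is -(i + 1)(m + 1)/m + i = -(m + 1)/m - i/m, whence a geometric growth in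
      -- i.
      have hpow : (J * A * ρ ^ (i + 1) * (‖η‖ * ρ ^ (i + 1)) ^ m) ^ (-(1 : ℝ) / m) * ρ ^ i =
          (J * ‖η‖ ^ m) ^ (-(1 : ℝ) / m) * ρ ^ (-(m + 1 : ℝ) / m) *
            (A ^ (-(1 : ℝ) / m) * (ρ ^ (-(1 : ℝ) / m)) ^ i) := by
        have e1 : J * A * ρ ^ (i + 1) * (‖η‖ * ρ ^ (i + 1)) ^ m =
            (J * ‖η‖ ^ m) * A * ρ ^ ((i + 1 : ℝ) * (m + 1 : ℝ)) := by
          have : ((i + 1 : ℝ) * (m + 1 : ℝ)) = ((i + 1) * (m + 1) : ℕ) := by push_cast; ring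
          rw [this, Real.rpow_natCast, pow_mul, pow_succ (ρ ^ (i + 1)), mul_pow]
          ring
        have e2 : ρ ^ i = ρ ^ (i : ℝ) := (Real.rpow_natCast _ _).symm
        have e3 : (ρ ^ (-(1 : ℝ) / m)) ^ i = ρ ^ (-(1 : ℝ) / m * i) := by
          rw [Real.rpow_mul hϖ0.le, Real.rpow_natCast]
        rw [e1, Real.mul_rpow (by positivity) (by positivity),
          Real.mul_rpow (by positivity) (by positivity), ← Real.rpow_mul hϖ0.le, e3]
        have e4 : ρ ^ ((i + 1 : ℝ) * (m + 1 : ℝ) * (-(1 : ℝ) / m)) * ρ ^ i =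
            ρ ^ (-(m + 1 : ℝ) / m) * ρ ^ (-(1 : ℝ) / m * i) := by
          rw [e2, ← Real.rpow_add hϖ0, ← Real.rpow_add hϖ0]
          congr 1
          field_simp
          ring
        linear_combination (J * ‖η‖ ^ m) ^ (-(1 : ℝ) / m) * A ^ (-(1 : ℝ) / m) * e4
      refine (mul_le_mul_of_nonneg_left hmeas (by positivity)).trans_eq ?_
      rw [mul_assoc, hpow]; ring
  obtain ⟨N, hN1, hN2⟩ := geometric_rpow_bound hP0 hϖ0 hϖ1 hm
  have hanti : Antitone fun i : ℕ => Metric.closedBall (0 : K) (ρ ^ i) := fun i j hij =>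
    Metric.closedBall_subset_closedBall (pow_le_pow_of_le_one hϖ0.le hϖ1.le hij)
  have hdec := norm_setIntegral_le_add_sum_sdiff (μ := μ) hanti
    (fun i => measurableSet_closedBall)
    (G := fun u : K => (ψ (P.eval u) : ℂ))
    (hcont.continuousOn.integrableOn_compact (isCompact_closedBall _ _)) N
  simp only [pow_zero] at hdec
  refine hdec.trans ?_
  rw [add_mul, one_mul]
  refine add_le_add ?_ ?_
  · refine (norm_setIntegral_addChar_le ?_ _).trans ((hball N).le.trans hN1)
    rw [hϖ]; exact ENNReal.ofReal_lt_top
  · refine (Finset.sum_le_sum fun i _ => hann i).trans ?_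
    rw [← Finset.mul_sum, mul_assoc _ (_ / _)]
    exact mul_le_mul_of_nonneg_left hN2 (by positivity)

/-- Van der Corput's lemma for polynomials over a local field, in terms of the coefficients. -/
theorem exists_norm_integral_addChar_eval_le (hK : IsNormalizedNorm K)
    (hψ : ∀ x : K, ‖x‖ < 1 → ψ x = 1) (hψ' : ∃ x : K, ‖x‖ ≤ 1 ∧ ψ x ≠ 1) (k : ℕ)
    (hk : ∀ i : ℕ, 1 ≤ i → i ≤ k → (i : K) ≠ 0) :
    ∃ ε : ℝ, 0 < ε ∧ ∀ j, 1 ≤ j → j ≤ k → ∃ C : ℝ, 0 ≤ C ∧ ∀ P : K[X], P.coeff j ≠ 0 →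
      (∀ i, j < i → ‖P.coeff i‖ ≤ ε * ‖P.coeff j‖) →
      ‖∫ u in Metric.closedBall (0 : K) 1, (ψ (P.eval u) : ℂ)
        ∂(Measure.addHaarMeasure (unitBall K))‖ ≤ C * ‖P.coeff j‖ ^ (-(1 : ℝ) / j) := by
  have : ProperSpace K := ProperSpace.of_locallyCompactSpace K
  obtain ⟨ε, hε0, hε1, hεk⟩ := exists_pos_lt_norm_natCast K k hk
  obtain ⟨ϖ, hϖ0, hϖ1, hϖ⟩ := exists_addHaarMeasure_closedBall_pow hK
  refine ⟨ε, hε0, fun j hj => ?_⟩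
  induction j, hj using Nat.le_induction with
  | base =>
    intro _
    refine ⟨1, zero_le_one, fun P hP0 hP => ?_⟩
    simpa [Real.rpow_neg_one] using norm_integral_addChar_eval_le_of_linear hψ hψ' hε1 hP0 hP
  | succ m hm ih =>
    intro hmk
    obtain ⟨C, hC, ih⟩ := ih (by omega)
    have hmε := hεk (m + 1) (by omega) hmk
    obtain ⟨η, hη0, hη⟩ := NormedField.exists_norm_lt K
      (mul_pos hε0 (hε0.trans hmε))
    have hβ : 0 < ‖ϖ‖ ^ (-(1 : ℝ) / m) - 1 := by
      rw [sub_pos]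
      refine Real.one_lt_rpow_of_pos_of_lt_one_of_neg hϖ0 hϖ1 ?_
      have : (0 : ℝ) < m := by exact_mod_cast hm
      rw [neg_div]; exact neg_neg_of_pos (by positivity)
    refine ⟨1 + C * (‖((m + 1 : ℕ) : K)‖ * ‖η‖ ^ m) ^ (-(1 : ℝ) / m) * ‖ϖ‖ ^ (-(m + 1 : ℝ) / m) *
        (‖ϖ‖ ^ (-(1 : ℝ) / m) / (‖ϖ‖ ^ (-(1 : ℝ) / m) - 1)), by positivity, fun P hP0 hP => ?_⟩
    have hA : 0 < ‖P.coeff (m + 1)‖ := norm_pos_iff.mpr hP0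
    rcases le_or_gt ‖P.coeff (m + 1)‖ 1 with hA1 | hA1
    · refine (norm_integral_unitBall_addChar_le_one _).trans ?_
      refine one_le_mul_of_one_le_of_one_le (le_add_of_nonneg_right (by positivity)) ?_
      refine Real.one_le_rpow_of_pos_of_le_one_of_nonpos hA hA1 ?_
      rw [neg_div]; exact neg_nonpos.mpr (by positivity)
    have hcont : Continuous fun x => ‖(taylor x P).coeff m‖ := by
      simp only [taylor_coeff]
      exact (Polynomial.continuous _).norm
    -- Recentring at this minimum makes it the origin; the domination of the tail and the norm of
    -- the coefficient m + 1 are preserved.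
    obtain ⟨c, hc, hcmin⟩ := (isCompact_closedBall (0 : K) 1).exists_isMinOn
      ⟨0, by simp⟩ hcont.continuousOn
    rw [mem_closedBall_zero_iff] at hc
    have hεA : 0 ≤ ε * ‖P.coeff (m + 1)‖ := by positivity
    have hnorm : ‖(taylor c P).coeff (m + 1)‖ = ‖P.coeff (m + 1)‖ := by
      have h2 : ‖(taylor c P).coeff (m + 1) - P.coeff (m + 1)‖ < ‖P.coeff (m + 1)‖ :=
        (norm_taylor_coeff_sub_le hεA hP hc).trans_lt (mul_lt_of_lt_one_left hA hε1)
      have := IsUltrametricDist.norm_add_eq_max_of_norm_ne_norm h2.ne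
      rwa [sub_add_cancel, max_eq_right h2.le] at this
    have hmain := norm_integral_addChar_eval_le_of_min hϖ0 hϖ1 hϖ hψ hε0 hε1 hm hmε hC ih hη0 hη.le
      (P := taylor c P) (by rwa [hnorm])
      (fun i hi => by rw [hnorm]; exact norm_taylor_coeff_le hεA hP hc hi)
      (fun x hx => by
        rw [taylor_taylor]
        refine hcmin ?_
        rw [mem_closedBall_zero_iff]
        exact (IsUltrametricDist.norm_add_le_max _ _).trans (max_le hx hc))
    rw [hnorm] at hmain
    refine le_trans (le_of_eq ?_) hmain
    congr 1
    rw [← integral_indicator measurableSet_closedBall, ← integral_indicator measurableSet_closedBall,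
      ← integral_add_right_eq_self _ c]
    congr 1
    ext u
    have hmem : u + c ∈ Metric.closedBall (0 : K) 1 ↔ u ∈ Metric.closedBall (0 : K) 1 := by
      rw [mem_closedBall_zero_iff, mem_closedBall_zero_iff]
      constructor <;> intro h
      · simpa using (norm_sub_le_max_norm (u + c) c).trans (max_le h hc)
      · exact (IsUltrametricDist.norm_add_le_max _ _).trans (max_le h hc)
    by_cases hu : u ∈ Metric.closedBall (0 : K) 1
    · rw [indicator_of_mem hu, indicator_of_mem (hmem.mpr hu), taylor_eval]
    · rw [indicator_of_notMem hu, indicator_of_notMem (mt hmem.mp hu)]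

end OscillatoryStep

end NonarchFourier

namespace NonarchFourier

/-! ### Power series on the diagonal and orders of vanishing -/

section PowerSeries

variable {K : Type*} [NontriviallyNormedField K]
  {E F : Type*} [NormedAddCommGroup E] [NormedSpace K E] [NormedAddCommGroup F] [NormedSpace K F]

/-- If `h - h a` vanishes to order `k + 1` at `a`, the terms of degree `1, …, k` of its power
series vanish on the diagonal. -/
theorem apply_diag_eq_zero_of_isBigO {h : E → F} {p : FormalMultilinearSeries K E F} {a : E}
    (hp : HasFPowerSeriesAt h p a) {k : ℕ}
    (hk : (fun y => h (a + y) - h a) =O[𝓝 0] fun y => ‖y‖ ^ (k + 1)) {n : ℕ} (hn : 1 ≤ n)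
    (hnk : n ≤ k) (y : E) : (p n fun _ => y) = 0 := by
  induction n using Nat.strong_induction_on generalizing y with
  | _ n ih =>
  refine Asymptotics.IsBigO.continuousMultilinearMap_apply_eq_zero ?_ y
  have h1 := hp.isBigO_sub_partialSum_pow (n + 1)
  have h2 : (fun y : E => h (a + y) - h a) =O[𝓝 0] fun y => ‖y‖ ^ (n + 1) := by
    refine hk.trans (Asymptotics.IsBigO.of_bound 1 ?_)
    filter_upwards [Metric.ball_mem_nhds (0 : E) one_pos] with y hy
    rw [mem_ball_zero_iff] at hy
    rw [one_mul, norm_pow, norm_pow, norm_norm]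
    exact pow_le_pow_of_le_one (norm_nonneg _) hy.le (by omega)
  refine (h2.sub h1).congr_left fun z => ?_
  have h0 : (p 0 fun _ => z) = h a := hp.coeff_zero _
  rw [FormalMultilinearSeries.partialSum, Finset.sum_range_succ]
  have : ∑ i ∈ Finset.range n, (p i fun _ => z) = h a := by
    rw [← h0]
    refine Finset.sum_eq_single_of_mem 0 (by simp; omega) fun i hi hi0 => ?_
    rw [Finset.mem_range] at hi
    exact ih i hi (by omega) (by omega) z
  rw [this]; abel

/-- The partial sum of degree ≤ k reduces to its constant term. With the converse above, the order
of vanishing is read off from diagonal values, without the factorials that derivatives carry. -/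
theorem isBigO_of_apply_diag_eq_zero {h : E → F} {p : FormalMultilinearSeries K E F} {a : E}
    (hp : HasFPowerSeriesAt h p a) {k : ℕ}
    (hk : ∀ n, 1 ≤ n → n ≤ k → ∀ y, (p n fun _ => y) = 0) :
    (fun y => h (a + y) - h a) =O[𝓝 0] fun y => ‖y‖ ^ (k + 1) := by
  refine (hp.isBigO_sub_partialSum_pow (k + 1)).congr_left fun z => ?_
  have h0 : (p 0 fun _ => z) = h a := hp.coeff_zero _
  rw [FormalMultilinearSeries.partialSum, ← h0]
  congr 1
  refine Finset.sum_eq_single_of_mem 0 (by simp) fun i hi hi0 => ?_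
  rw [Finset.mem_range] at hi
  exact hk i (by omega) (by omega) z

/-- A term of a power series which vanishes on the diagonal does not contribute to the iterated
derivatives. -/
theorem iteratedFDeriv_eq_zero_of_apply_diag_eq_zero [CompleteSpace F] {h : E → F}
    {p : FormalMultilinearSeries K E F} {a : E} (hp : HasFPowerSeriesAt h p a) {n : ℕ}
    (hn : ∀ y, (p n fun _ => y) = 0) : iteratedFDeriv K n h a = 0 := by
  obtain ⟨r, hr⟩ := hp
  -- `p n` itself need not vanish, for instance if it is alternating. Replacing it by 0 gives
  -- another power series of the same function, and the n-th derivative can be computed from that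
  -- one.
  let q : FormalMultilinearSeries K E F := fun m => if m = n then 0 else p m
  have hq : HasFPowerSeriesOnBall h q a r := by
    refine ⟨?_, hr.r_pos, fun {y} hy => ?_⟩
    · refine ENNReal.le_of_forall_nnreal_lt fun s hs => ?_
      obtain ⟨C, hC0, hC⟩ := p.norm_mul_pow_le_of_lt_radius (hs.trans_le hr.r_le)
      refine q.le_radius_of_bound C fun m => ?_
      by_cases hm : m = n
      · simp [q, hm, hC0.le]
      · simpa [q, hm] using hC m
    · refine (hr.hasSum hy).congr_fun fun m => ?_
      by_cases hm : m = n
      · subst hm; simp [q, hn]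
      · simp [q, hm]
  ext w
  rw [hq.iteratedFDeriv_eq_sum_of_completeSpace]
  simp [q]

theorem iteratedFDeriv_apply_eq_of_equiv [CompleteSpace F] {h : E → F} {a : E}
    (ha : AnalyticAt K h a) {n m : ℕ} (e : Fin n ≃ Fin m) (w : Fin m → E) :
    iteratedFDeriv K n h a (w ∘ e) = iteratedFDeriv K m h a w := by
  obtain rfl : n = m := by simpa using Fintype.card_congr e
  exact ContDiffAt.iteratedFDeriv_comp_perm ha.contDiffAt w e

end PowerSeries

/-! ### Partial derivatives, and their invariance under changes of variables -/

section MultiDeriv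

variable {K : Type*} [NontriviallyNormedField K] [CompleteSpace K] {n d : ℕ}

/-- The list of indices, with multiplicity, of a multi-index. -/
def multiIndexList (α : Fin d → ℕ) : List (Fin d) :=
  (List.finRange d).flatMap fun i => List.replicate (α i) i

theorem length_multiIndexList (α : Fin d → ℕ) : (multiIndexList α).length = ∑ i, α i := by
  simp [multiIndexList, List.length_flatMap, ← List.sum_ofFn, List.ofFn_eq_map]

theorem count_multiIndexList (α : Fin d → ℕ) (i : Fin d) :
    (multiIndexList α).count i = α i := by
  rw [multiIndexList, List.count_flatMap]
  have : (List.count i ∘ fun j => List.replicate (α j) j) = fun j => if j = i then α j else 0 := by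
    ext j; simp [List.count_replicate]
  rw [this, ← List.ofFn_eq_map, List.sum_ofFn]
  simp

omit [CompleteSpace K] in
theorem multiDeriv_eq_foldr (α : Fin d → ℕ) (f : (Fin d → K) → (Fin n → K)) :
    multiDeriv α f = (multiIndexList α).foldr partialDeriv f := by
  rw [multiDeriv, multiIndexList]
  generalize List.finRange d = l
  induction l with
  | nil => rfl
  | cons i l ih =>
    rw [List.foldr_cons, ih, List.flatMap_cons, List.foldr_append]
    generalize α i = m
    induction m with
    | zero => rfl
    | succ m ihm => rw [Function.iterate_succ_apply', ihm, List.replicate_succ, List.foldr_cons]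

theorem analyticAt_iteratedFDeriv {f : (Fin d → K) → (Fin n → K)} {x : Fin d → K}
    (hf : AnalyticAt K f x) (m : ℕ) : AnalyticAt K (iteratedFDeriv K m f) x := by
  obtain ⟨s, hs, h⟩ := hf.exists_mem_nhds_analyticOnNhd
  exact h.iteratedFDeriv m x (mem_of_mem_nhds hs)

theorem foldr_partialDeriv_eq {f : (Fin d → K) → (Fin n → K)} (l : List (Fin d))
    {x : Fin d → K} (hf : AnalyticAt K f x) :
    l.foldr partialDeriv f x =
      iteratedFDeriv K l.length f x fun j => Pi.single (l.get j) (1 : K) := by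
  induction l generalizing x with
  | nil => simp
  | cons i l ih =>
    have h1 : l.foldr partialDeriv f =ᶠ[𝓝 x] fun z =>
        iteratedFDeriv K l.length f z fun j => Pi.single (l.get j) (1 : K) := by
      filter_upwards [hf.eventually_analyticAt] with z hz using ih hz
    rw [List.foldr_cons, partialDeriv, h1.fderiv_eq,
      fderiv_continuousMultilinear_apply_const (analyticAt_iteratedFDeriv hf _).differentiableAt]
    change _ = iteratedFDeriv K (l.length + 1) f x _
    rw [iteratedFDeriv_succ_apply_left]
    rfl

theorem multiDeriv_eq_iteratedFDeriv {f : (Fin d → K) → (Fin n → K)} (α : Fin d → ℕ)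
    {x : Fin d → K} (hf : AnalyticAt K f x) :
    multiDeriv α f x = iteratedFDeriv K (multiIndexList α).length f x
      fun j => Pi.single ((multiIndexList α).get j) (1 : K) := by
  rw [multiDeriv_eq_foldr, foldr_partialDeriv_eq _ hf]

theorem analyticAt_multiDeriv {f : (Fin d → K) → (Fin n → K)} (α : Fin d → ℕ)
    {x : Fin d → K} (hf : AnalyticAt K f x) : AnalyticAt K (multiDeriv α f) x := by
  rw [multiDeriv_eq_foldr]
  induction multiIndexList α with
  | nil => exact hf
  | cons i l ih => exact ((ContinuousLinearMap.apply K (Fin n → K) (Pi.single i 1)).analyticAt _).comp ih.fderiv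

/-- The linear form `x ↦ v · x`. -/
noncomputable def dotCLM (v : Fin n → K) : (Fin n → K) →L[K] K :=
  ∑ i, v i • ContinuousLinearMap.proj i

omit [CompleteSpace K] in
theorem dotCLM_apply (v x : Fin n → K) : dotCLM v x = v ⬝ᵥ x := by
  simp [dotCLM, dotProduct]

theorem dotProduct_multiDeriv {f : (Fin d → K) → (Fin n → K)} (α : Fin d → ℕ) (v : Fin n → K)
    {x : Fin d → K} (hf : AnalyticAt K f x) :
    v ⬝ᵥ multiDeriv α f x = iteratedFDeriv K (multiIndexList α).length (dotCLM v ∘ f) x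
      fun j => Pi.single ((multiIndexList α).get j) (1 : K) := by
  rw [(dotCLM v).iteratedFDeriv_comp_left (n := ⊤) hf.contDiffAt (by exact_mod_cast le_top),
    multiDeriv_eq_iteratedFDeriv α hf]
  simp [dotCLM_apply]

omit [CompleteSpace K] in
theorem analyticAt_dotCLM_comp {f : (Fin d → K) → (Fin n → K)} (v : Fin n → K)
    {x : Fin d → K} (hf : AnalyticAt K f x) : AnalyticAt K (dotCLM v ∘ f) x :=
  (dotCLM v).analyticAt _ |>.comp hf

/-- If all partial derivatives of `v · f` vanish at `a`, then it is locally constant, in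
characteristic zero. -/
theorem eventually_dotProduct_eq [CharZero K] {f : (Fin d → K) → (Fin n → K)} {a : Fin d → K}
    (hf : AnalyticAt K f a) {v : Fin n → K}
    (hv : ∀ α : Fin d → ℕ, 0 < ∑ i, α i → v ⬝ᵥ multiDeriv α f a = 0) :
    ∀ᶠ x in 𝓝 a, v ⬝ᵥ f x = v ⬝ᵥ f a := by
  have hh := analyticAt_dotCLM_comp v hf
  have hD : ∀ m, 1 ≤ m → iteratedFDeriv K m (dotCLM v ∘ f) a = 0 := by
    intro m hm
    apply ContinuousMultilinearMap.toMultilinearMap_injective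
    refine Module.Basis.ext_multilinear (fun _ => Pi.basisFun K (Fin d)) fun w => ?_
    simp only [Pi.basisFun_apply, ContinuousMultilinearMap.coe_coe]
    -- The tuple `w` is a rearrangement of the index list of the multi-index counting its entries,
    -- and iterated derivatives are symmetric.
    let α : Fin d → ℕ := fun i => (List.ofFn w).count i
    have hperm : (List.ofFn w).Perm (multiIndexList α) := by
      rw [List.perm_iff_count]
      intro i
      rw [count_multiIndexList]
    have hlen : (multiIndexList α).length = m := by rw [← hperm.length_eq, List.length_ofFn]
    have h0 := hv α (by rw [← length_multiIndexList, hlen]; omega)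
    rw [dotProduct_multiDeriv α v hf] at h0
    let e₁ : Fin m ≃ Fin (List.ofFn w).length := finCongr (List.length_ofFn).symm
    let e₂ : Fin (List.ofFn w).length ≃ Fin (multiIndexList α).length :=
      ⟨hperm.idxBij, hperm.symm.idxBij, hperm.idxBij_symm_leftInverse_idxBij,
        hperm.idxBij_symm_rightInverse_idxBij⟩
    rw [← iteratedFDeriv_apply_eq_of_equiv hh (e₁.trans e₂)] at h0
    have hw : (fun j => (Pi.single ((multiIndexList α).get j) (1 : K) : Fin d → K)) ∘ (e₁.trans e₂) =
        fun j => (Pi.single (w j) (1 : K) : Fin d → K) := by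
      ext j : 1
      have : (multiIndexList α).get (e₂ (e₁ j)) = w j := by
        simp [e₂, e₁, List.get_eq_getElem]
      rw [Function.comp_apply, Equiv.trans_apply, this]
    rw [hw] at h0
    rw [h0]; rfl
  obtain ⟨p, r, hr⟩ := hh
  have hp : ∀ m, 1 ≤ m → ∀ y, (p m fun _ => y) = 0 := by
    intro m hm y
    -- On the diagonal the sum over permutations is m! times the term of degree m, and m! ≠ 0 in
    -- characteristic zero.
    have h1 := hr.iteratedFDeriv_eq_sum_of_completeSpace (n := m) fun _ => y
    rw [hD m hm] at h1
    simp only [zero_apply, Finset.sum_const, Finset.card_univ,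
      Fintype.card_perm, Fintype.card_fin] at h1
    simpa [Nat.factorial_ne_zero] using h1.symm
  filter_upwards [Metric.eball_mem_nhds a hr.r_pos] with x hx
  have h1 := hr.hasSum_sub hx
  have h2 := hasSum_single (f := fun m => p m fun _ => x - a) 0 fun m hm => hp m (by omega) _
  rw [hr.coeff_zero] at h2
  have := h1.unique h2
  simpa [dotCLM_apply] using this

/-- A linear form whose composition with `f` has a nonzero partial derivative of order at most `k`
has a nonzero homogeneous term of order at most `k` in any analytic parametrization obtained from
`f` by a change of variables. -/
theorem exists_apply_diag_ne_zero {f g : (Fin d → K) → (Fin n → K)} {φ : (Fin d → K) → (Fin d → K)}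
    {a b : Fin d → K} (hf : AnalyticAt K f a) {p : FormalMultilinearSeries K (Fin d → K) (Fin n → K)}
    (hg : HasFPowerSeriesAt g p b) (hφ : DifferentiableAt K φ a) (hφa : φ a = b)
    (hfg : f =ᶠ[𝓝 a] g ∘ φ) {k : ℕ} {v : Fin n → K} {α : Fin d → ℕ} (hα : 0 < ∑ i, α i)
    (hαk : ∑ i, α i ≤ k) (hv : v ⬝ᵥ multiDeriv α f a ≠ 0) :
    ∃ m, 1 ≤ m ∧ m ≤ k ∧ ∃ y, v ⬝ᵥ (p m fun _ => y) ≠ 0 := by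
  by_contra! hcon
  apply hv
  have hvg : HasFPowerSeriesAt (dotCLM v ∘ g) ((dotCLM v).compFormalMultilinearSeries p) b :=
    hg.imp fun r hr => (dotCLM v).comp_hasFPowerSeriesOnBall hr
  -- Vanishing terms mean that v · g is constant up to O(‖y‖^(k+1)). This passes to v · f by
  -- composition with the differentiable φ, and then kills its derivatives of order 1 to k.
  have h1 := isBigO_of_apply_diag_eq_zero hvg (k := k) (fun m hm hmk y => by
    simpa [dotCLM_apply] using hcon m hm hmk y)
  have hvf := analyticAt_dotCLM_comp v hf
  obtain ⟨q, hq⟩ := hvf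
  have h2 : (fun y => (dotCLM v ∘ f) (a + y) - (dotCLM v ∘ f) a) =O[𝓝 0]
      fun y => ‖y‖ ^ (k + 1) := by
    have ht : Tendsto (fun y => φ (a + y) - φ a) (𝓝 0) (𝓝 0) := by
      have : ContinuousAt (fun y => φ (a + y) - φ a) 0 := by
        refine ContinuousAt.sub (ContinuousAt.comp ?_ (by fun_prop)) continuousAt_const
        simpa using hφ.continuousAt
      simpa [ContinuousAt] using this
    have h3 := (h1.comp_tendsto ht)
    have h4 : (fun y => φ (a + y) - φ a) =O[𝓝 0] fun y => y := by
      have := hφ.hasFDerivAt.isBigO_sub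
      have ht' : Tendsto (fun y => a + y) (𝓝 0) (𝓝 a) := by
        have : ContinuousAt (fun y => a + y) 0 := by fun_prop
        simpa [ContinuousAt] using this
      simpa [Function.comp_def] using this.comp_tendsto ht'
    refine (h3.trans (h4.norm_norm.pow (k + 1))).congr' ?_ EventuallyEq.rfl
    have ht' : Tendsto (fun y => a + y) (𝓝 0) (𝓝 a) := by
      have : ContinuousAt (fun y => a + y) 0 := by fun_prop
      simpa [ContinuousAt] using this
    filter_upwards [ht'.eventually hfg] with y hy
    have hy0 := hfg.self_of_nhds
    simp only [Function.comp_apply] at hy hy0 ⊢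
    rw [hy, hy0, hφa]
    simp
  rw [dotProduct_multiDeriv α v hf, iteratedFDeriv_eq_zero_of_apply_diag_eq_zero hq]
  · rfl
  · intro y
    rw [length_multiIndexList]
    exact apply_diag_eq_zero_of_isBigO hq h2 hα hαk y

end MultiDeriv

end NonarchFourier

namespace NonarchFourier

/-! ### Finite type: existence of k -/

section FiniteType

variable {K : Type*} [NontriviallyNormedField K] {n d : ℕ}

/-- The maximum norm takes its values in |K|, so dividing by a coordinate of largest norm normalizes
v exactly. -/
theorem exists_smul_eq_of_ne_zero {v : Fin n → K} (hv : v ≠ 0) :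
    ∃ (c : K) (w : Fin n → K), c ≠ 0 ∧ ‖c‖ = ‖v‖ ∧ ‖w‖ = 1 ∧ v = c • w := by
  have hne : Nonempty (Fin n) := by
    by_contra h
    rw [not_nonempty_iff] at h
    exact hv (Subsingleton.elim _ _)
  obtain ⟨i, hi⟩ : ∃ i, ‖v i‖ = ‖v‖ := by
    obtain ⟨i, -, hi⟩ := Finset.exists_mem_eq_sup Finset.univ Finset.univ_nonempty fun i => ‖v i‖₊
    exact ⟨i, by rw [Pi.norm_def, hi]; rfl⟩
  have hvi : v i ≠ 0 := by
    rw [← norm_pos_iff, hi]; exact norm_pos_iff.mpr hv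
  refine ⟨v i, (v i)⁻¹ • v, hvi, hi, ?_, by rw [smul_inv_smul₀ hvi]⟩
  rw [norm_smul, norm_inv, hi, inv_mul_cancel₀ (norm_ne_zero_iff.mpr hv)]

theorem continuous_coordProj (σ : Fin d ↪ Fin n) : Continuous (coordProj (K := K) σ) :=
  continuous_pi fun i => continuous_apply (σ i)

namespace IsAnalyticChart

variable {M U : Set (Fin n → K)} {σ : Fin d ↪ Fin n} {U' : Set (Fin d → K)}
  {f : (Fin d → K) → (Fin n → K)}

theorem subset (h : IsAnalyticChart M U σ U' f) : U ⊆ M := by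
  obtain ⟨O, -, rfl⟩ := h.relOpen
  exact inter_subset_left

theorem apply_mem (h : IsAnalyticChart M U σ U' f) {z : Fin d → K} (hz : z ∈ U') : f z ∈ U := by
  obtain ⟨x, hx, rfl⟩ := h.bijOn.surjOn hz
  rwa [h.invOn.1 hx]

theorem coordProj_mem (h : IsAnalyticChart M U σ U' f) {x : Fin n → K} (hx : x ∈ U) :
    coordProj σ x ∈ U' :=
  h.bijOn.mapsTo hx

theorem restrict (h : IsAnalyticChart M U σ U' f) {O : Set (Fin n → K)} (hO : IsOpen O) :
    IsAnalyticChart (M ∩ O) (U ∩ O) σ (U' ∩ f ⁻¹' O) f where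
  relOpen := by
    obtain ⟨O', hO', hU⟩ := h.relOpen
    exact ⟨O', hO', by rw [hU]; ac_rfl⟩
  isOpen := h.analytic.continuousOn.isOpen_inter_preimage h.isOpen hO
  bijOn := by
    refine ⟨fun x hx => ⟨h.coordProj_mem hx.1, ?_⟩, h.bijOn.injOn.mono inter_subset_left, ?_⟩
    · rw [mem_preimage, h.invOn.1 hx.1]; exact hx.2
    · rintro z ⟨hz, hz'⟩
      exact ⟨f z, ⟨h.apply_mem hz, hz'⟩, h.invOn.2 hz⟩
  invOn := h.invOn.mono inter_subset_left inter_subset_left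
  analytic := h.analytic.mono inter_subset_left

end IsAnalyticChart

theorem HasTypeLEAt.restrict {M : Set (Fin n → K)} {k : ℕ} {x : Fin n → K}
    (h : HasTypeLEAt d M k x) {O : Set (Fin n → K)} (hO : IsOpen O) (hx : x ∈ O) :
    HasTypeLEAt d (M ∩ O) k x := by
  obtain ⟨U, σ, U', f, hf, hxU, hv⟩ := h
  exact ⟨U ∩ O, σ, _, f, hf.restrict hO, ⟨hxU, hx⟩, hv⟩

theorem HasTypeLEAt.mono {M : Set (Fin n → K)} {k l : ℕ} {x : Fin n → K}
    (h : HasTypeLEAt d M k x) (hkl : k ≤ l) : HasTypeLEAt d M l x := by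
  obtain ⟨U, σ, U', f, hf, hxU, hv⟩ := h
  refine ⟨U, σ, U', f, hf, hxU, fun v hv0 => ?_⟩
  obtain ⟨α, h0, h1, h2⟩ := hv v hv0
  exact ⟨α, h0, h1.trans hkl, h2⟩

/-- In characteristic zero the hyperplane condition implies the derivative condition. -/
theorem NotLocallyInHyperplaneAt.exists_hasTypeLEAt [CompleteSpace K] [CharZero K]
    {M : Set (Fin n → K)} (hM : IsAnalyticManifold d M) {x₀ : Fin n → K} (hx₀ : x₀ ∈ M)
    (h : NotLocallyInHyperplaneAt M x₀) : ∃ k, HasTypeLEAt d M k x₀ := by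
  obtain ⟨U, σ, U', f, hf, hxU⟩ := hM x₀ hx₀
  set a := coordProj σ x₀
  have ha : a ∈ U' := hf.coordProj_mem hxU
  have hfa : f a = x₀ := hf.invOn.1 hxU
  -- The vectors killing all derivatives of order 1 to k form a decreasing chain of subspaces of
  -- K^n, which stabilizes. A nonzero vector in the limit would make v · f locally constant, putting
  -- a neighbourhood into a hyperplane.
  let V : ℕ →o (Submodule K (Fin n → K))ᵒᵈ :=
    { toFun := fun k => OrderDual.toDual
        { carrier := {v | ∀ α : Fin d → ℕ, 0 < ∑ i, α i → ∑ i, α i ≤ k →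
            v ⬝ᵥ multiDeriv α f a = 0}
          add_mem' := fun {v w} hv hw α h0 h1 => by
            rw [add_dotProduct, hv α h0 h1, hw α h0 h1, add_zero]
          zero_mem' := fun α _ _ => zero_dotProduct _
          smul_mem' := fun c v hv α h0 h1 => by rw [smul_dotProduct, hv α h0 h1, smul_zero] }
      monotone' := fun k l hkl v hv α h0 h1 => hv α h0 (h1.trans hkl) }
  obtain ⟨N, hN⟩ := IsArtinian.monotone_stabilizes V
  refine ⟨N, U, σ, U', f, hf, hxU, fun v hv => ?_⟩
  by_contra! hcon
  have hall : ∀ α : Fin d → ℕ, 0 < ∑ i, α i → v ⬝ᵥ multiDeriv α f a = 0 := by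
    intro α h0
    have hmem : v ∈ OrderDual.ofDual (V N) := fun α h0 h1 => hcon α h0 h1
    rw [hN (max N (∑ i, α i)) (le_max_left _ _)] at hmem
    exact hmem α h0 (le_max_right _ _)
  have hev := eventually_dotProduct_eq (hf.analytic a ha) hall
  rw [hfa] at hev
  obtain ⟨W, hW, hWo, haW⟩ := _root_.eventually_nhds_iff.mp hev
  obtain ⟨O, hO, hUO⟩ := hf.relOpen
  refine h v hv (O ∩ coordProj σ ⁻¹' W) (hO.inter (hWo.preimage (continuous_coordProj σ)))
    ⟨(hUO ▸ hxU : x₀ ∈ M ∩ O).2, haW⟩ ?_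
  rintro x ⟨hxM, hxO, hxW⟩
  have hxU : x ∈ U := by rw [hUO]; exact ⟨hxM, hxO⟩
  have := hW _ hxW
  rwa [hf.invOn.1 hxU] at this

/-- For unit v, a nonzero v · ∂^α f stays nonzero for nearby points and nearby v. Compactness of the
unit sphere yields one neighbourhood valid for all v, and scaling covers the other vectors. -/
theorem HasTypeLEAt.eventually [LocallyCompactSpace K] {M : Set (Fin n → K)} {k : ℕ}
    {x₀ : Fin n → K} (h : HasTypeLEAt d M k x₀) : ∀ᶠ x in 𝓝[M] x₀, HasTypeLEAt d M k x := by
  have : ProperSpace K := ProperSpace.of_locallyCompactSpace K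
  obtain ⟨U, σ, U', f, hf, hxU, hv⟩ := h
  set a := coordProj σ x₀ with hadef
  have ha : a ∈ U' := hf.coordProj_mem hxU
  have h1 : ∀ᶠ z in 𝓝 a, ∀ v ∈ Metric.sphere (0 : Fin n → K) 1, ∃ α : Fin d → ℕ,
      0 < ∑ i, α i ∧ ∑ i, α i ≤ k ∧ v ⬝ᵥ multiDeriv α f z ≠ 0 := by
    refine (isCompact_sphere (0 : Fin n → K) 1).eventually_forall_of_forall_eventually fun v hv1 => ?_
    obtain ⟨α, h0, h1, h2⟩ := hv v (by rintro rfl; simp at hv1)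
    have hc : ContinuousAt (fun p : (Fin d → K) × (Fin n → K) => p.2 ⬝ᵥ multiDeriv α f p.1) (a, v) := by
      have hc1 : ContinuousAt (fun p : (Fin d → K) × (Fin n → K) => multiDeriv α f p.1) (a, v) :=
        (analyticAt_multiDeriv α (hf.analytic a ha)).continuousAt.comp_of_eq continuousAt_fst rfl
      simp only [dotProduct]
      refine tendsto_finsetSum _ fun i _ => ?_
      refine ContinuousAt.mul ?_ ?_
      · exact ((continuous_apply i).comp continuous_snd).continuousAt
      · exact (continuous_apply i).continuousAt.comp hc1
    filter_upwards [hc.eventually_ne h2] with p hp using ⟨α, h0, h1, hp⟩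
  obtain ⟨O, hO, hUO⟩ := hf.relOpen
  have h2 : ∀ᶠ x in 𝓝[M] x₀, x ∈ U := by
    rw [hUO]
    filter_upwards [self_mem_nhdsWithin,
      mem_nhdsWithin_of_mem_nhds (hO.mem_nhds (hUO ▸ hxU : x₀ ∈ M ∩ O).2)] with x h1 h2
    exact ⟨h1, h2⟩
  have h3 := (continuous_coordProj (K := K) σ).continuousAt.tendsto.eventually (hadef ▸ h1)
  filter_upwards [h2, nhdsWithin_le_nhds h3] with x hxU hx
  refine ⟨U, σ, U', f, hf, hxU, fun v hv0 => ?_⟩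
  obtain ⟨c, w, hc, -, hw, rfl⟩ := exists_smul_eq_of_ne_zero hv0
  obtain ⟨α, h0, h1, h2⟩ := hx w (by simpa using hw)
  exact ⟨α, h0, h1, by rw [smul_dotProduct]; exact smul_ne_zero hc h2⟩

/-- A compact open subset of a manifold of finite type is of type `k` for some `k`. -/
theorem exists_isOfType [LocallyCompactSpace K] {M S : Set (Fin n → K)}
    (hM : IsAnalyticManifold d M) (hM_fin : IsFiniteType d M) (hS : IsCompact S)
    (hS_open : ∃ O : Set (Fin n → K), IsOpen O ∧ S = M ∩ O) : ∃ k, IsOfType d S k := by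
  have : ProperSpace K := ProperSpace.of_locallyCompactSpace K
  obtain ⟨O, hO, hSO⟩ := hS_open
  have hpt : ∀ x ∈ S, ∃ k, HasTypeLEAt d S k x := by
    intro x hx
    rw [hSO] at hx
    have hk : ∃ k, HasTypeLEAt d M k x := by
      rcases hM_fin x hx.1 with ⟨k, -, hk⟩ | ⟨hchar, hk⟩
      · exact ⟨k, hk⟩
      · exact hk.exists_hasTypeLEAt hM hx.1
    obtain ⟨k, hk⟩ := hk
    exact ⟨k, hSO ▸ hk.restrict hO hx.2⟩
  have hall : ∃ k, ∀ x ∈ S, HasTypeLEAt d S k x := by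
    refine hS.induction_on (p := fun T => ∃ k, ∀ x ∈ T, HasTypeLEAt d S k x) ⟨0, by simp⟩
      (fun s t hst ⟨k, hk⟩ => ⟨k, fun x hx => hk x (hst hx)⟩) ?_ ?_
    · rintro s t ⟨k, hk⟩ ⟨l, hl⟩
      refine ⟨max k l, ?_⟩
      rintro x (hx | hx)
      · exact (hk x hx).mono (le_max_left _ _)
      · exact (hl x hx).mono (le_max_right _ _)
    · intro x hx
      obtain ⟨k, hk⟩ := hpt x hx
      exact ⟨_, hk.eventually, k, fun y hy => hy⟩
  obtain ⟨k, hk⟩ := hall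
  classical
  have hex : ∃ k, 0 < k ∧ ∀ x ∈ S, HasTypeLEAt d S k x :=
    -- The uniform bound may be 0, for instance when `S` is empty.
    ⟨k + 1, k.succ_pos, fun x hx => (hk x hx).mono k.le_succ⟩
  exact ⟨Nat.find hex, Nat.find_spec hex, fun l hl => Nat.find_min' hex hl⟩

end FiniteType

end NonarchFourier

namespace NonarchFourier

/-! ### Maximal minors of largest norm -/

section LinearAlgebra

variable {K : Type*} [NontriviallyNormedField K] {n d : ℕ}

/-- Among the maximal minors of a matrix of full column rank choose one of largest absolute value:
expressing the rows in terms of those of the minor only needs coefficients of norm at most one. -/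
theorem exists_submatrix_norm_le_one (L : Matrix (Fin n) (Fin d) K) (σ : Fin d → Fin n)
    (hσ : (L.submatrix σ id).det ≠ 0) :
    ∃ τ : Fin d ↪ Fin n, IsUnit (L.submatrix τ id).det ∧
      ∀ i j, ‖(L * (L.submatrix τ id)⁻¹) i j‖ ≤ 1 := by
  have : Nonempty (Fin d → Fin n) := ⟨σ⟩
  obtain ⟨τ, hτ⟩ := Finite.exists_max fun τ : Fin d → Fin n => ‖(L.submatrix τ id).det‖
  have hpos : 0 < ‖(L.submatrix τ id).det‖ := (norm_pos_iff.mpr hσ).trans_le (hτ σ)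
  have hunit : IsUnit (L.submatrix τ id).det := isUnit_iff_ne_zero.mpr (norm_pos_iff.mp hpos)
  have hinj : Function.Injective τ := by
    intro i j hij
    by_contra hne
    apply norm_pos_iff.mp hpos
    refine Matrix.det_zero_of_row_eq hne ?_
    ext l
    simp [hij]
  refine ⟨⟨τ, hinj⟩, hunit, fun i j => ?_⟩
  change ‖(L * (L.submatrix τ id)⁻¹) i j‖ ≤ 1
  set N := L.submatrix τ id with hN
  set w := (L * N⁻¹) i with hw
  have hrow : N.transpose.mulVec w = L i := by
    rw [Matrix.mulVec_transpose]
    have : (L * N⁻¹ * N) i = L i := by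
      rw [Matrix.mul_assoc, Matrix.nonsing_inv_mul _ hunit, Matrix.mul_one]
    rw [← this]
    rfl
  have hsub : L.submatrix (Function.update τ j i) id = N.updateRow j (L i) := by
    ext r c
    rcases eq_or_ne r j with rfl | h
    · simp
    · simp [h, hN]
  -- Cramer's rule. The left side is again a maximal minor of `L`, so the maximality of `N` gives |w
  -- j| ≤ 1.
  have hdet : (N.updateRow j (L i)).det = N.det * w j := by
    rw [← Matrix.cramer_transpose_apply, Matrix.cramer_eq_adjugate_mulVec, ← hrow,
      Matrix.mulVec_mulVec, Matrix.adjugate_mul, Matrix.smul_mulVec, Matrix.one_mulVec,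
      Matrix.det_transpose]
    rfl
  have := hτ (Function.update τ j i)
  rw [hsub, hdet, norm_mul] at this
  exact (mul_le_iff_le_one_right hpos).mp this

theorem norm_mulVec_le_of_norm_le_one [IsUltrametricDist K] {A : Matrix (Fin n) (Fin d) K}
    (hA : ∀ i j, ‖A i j‖ ≤ 1) (w : Fin d → K) : ‖A.mulVec w‖ ≤ ‖w‖ := by
  rw [pi_norm_le_iff_of_nonneg (norm_nonneg _)]
  intro i
  rw [Matrix.mulVec, dotProduct]
  refine IsUltrametricDist.norm_sum_le_of_forall_le_of_nonneg (norm_nonneg w) fun j _ => ?_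
  rw [norm_mul]
  exact (mul_le_of_le_one_left (norm_nonneg _) (hA i j)).trans (norm_le_pi_norm w j)

end LinearAlgebra

/-! ### Existence of isometric charts -/

section IsometricChart

variable {K : Type*} [NontriviallyNormedField K] [IsUltrametricDist K] [CompleteSpace K] {n d : ℕ}

omit [IsUltrametricDist K] [CompleteSpace K] in
theorem dist_coordProj_le (σ : Fin d ↪ Fin n) (x y : Fin n → K) :
    dist (coordProj σ x) (coordProj σ y) ≤ dist x y := by
  rw [dist_pi_le_iff dist_nonneg]
  exact fun i => dist_le_pi_dist x y (σ i)

/-- The coordinate projection as a continuous linear map. -/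
noncomputable def coordProjCLM (σ : Fin d ↪ Fin n) : (Fin n → K) →L[K] (Fin d → K) :=
  ContinuousLinearMap.pi fun i => ContinuousLinearMap.proj (σ i)

/-- Around each point of an analytic chart there is an isometric chart, related to it by an
analytic change of variables. -/
theorem IsAnalyticChart.exists_isIsometricChart {M U : Set (Fin n → K)} {σ : Fin d ↪ Fin n}
    {U' : Set (Fin d → K)} {f : (Fin d → K) → (Fin n → K)} (hf : IsAnalyticChart M U σ U' f)
    {x₀ : Fin n → K} (hx₀ : x₀ ∈ U) :
    ∃ (V : Set (Fin n → K)) (τ : Fin d ↪ Fin n) (V' : Set (Fin d → K))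
      (g : (Fin d → K) → (Fin n → K)) (φ : (Fin d → K) → (Fin d → K)),
      IsIsometricChart M V τ V' g ∧ x₀ ∈ V ∧ DifferentiableAt K φ (coordProj σ x₀) ∧
      φ (coordProj σ x₀) = coordProj τ x₀ ∧ f =ᶠ[𝓝 (coordProj σ x₀)] g ∘ φ := by
  set a := coordProj σ x₀ with hadef
  have ha : a ∈ U' := hf.coordProj_mem hx₀
  have hfa : f a = x₀ := hf.invOn.1 hx₀
  have hfan := hf.analytic a ha
  set L : (Fin d → K) →L[K] (Fin n → K) := fderiv K f a with hL
  set A : Matrix (Fin n) (Fin d) K := LinearMap.toMatrix' (L : (Fin d → K) →ₗ[K] (Fin n → K)) with hA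
  have hAL : ∀ w, A.mulVec w = L w := fun w => by
    rw [hA, ← Matrix.toLin'_apply, Matrix.toLin'_toMatrix']; rfl
  have hσL : ∀ w, coordProj σ (L w) = w := by
    have h1 : (coordProjCLM σ ∘ f) =ᶠ[𝓝 a] id := by
      filter_upwards [hf.isOpen.mem_nhds ha] with z hz
      exact hf.invOn.2 hz
    have h2 : HasFDerivAt (coordProjCLM σ ∘ f) ((coordProjCLM σ).comp L) a :=
      (coordProjCLM σ).hasFDerivAt.comp a hfan.differentiableAt.hasFDerivAt
    have h3 := (h2.congr_of_eventuallyEq h1.symm).unique (hasFDerivAt_id a)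
    intro w
    exact DFunLike.congr_fun h3 w
  -- The rows selected by σ form the identity matrix, so a nonzero maximal minor exists.
  have hdetσ : (A.submatrix σ id).det ≠ 0 := by
    have : A.submatrix σ id = 1 := by
      rw [← Matrix.toLin'.injective.eq_iff, Matrix.toLin'_one]
      apply LinearMap.ext
      intro w
      have : (A.submatrix σ id).mulVec w = coordProj σ (A.mulVec w) := rfl
      rw [Matrix.toLin'_apply, this, hAL, hσL]; rfl
    rw [this, Matrix.det_one]; exact one_ne_zero
  obtain ⟨τ, hunit, hle⟩ := exists_submatrix_norm_le_one A σ hdetσ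
  set N := A.submatrix τ id with hN
  have hNL : ∀ w, N.mulVec w = coordProj τ (L w) := fun w => by
    rw [← hAL]; rfl
  let e : (Fin d → K) ≃L[K] (Fin d → K) :=
    (LinearEquiv.ofBijective (Matrix.toLin' N) (by
      have hu : IsUnit N := (Matrix.isUnit_iff_isUnit_det _).mpr hunit
      exact ⟨Matrix.mulVec_injective_iff_isUnit.mpr hu,
        Matrix.mulVec_surjective_iff_isUnit.mpr hu⟩)).toContinuousLinearEquiv
  have he : ∀ w, e w = N.mulVec w := fun w => rfl
  have hesymm : ∀ w, e.symm w = N⁻¹.mulVec w := by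
    intro w
    rw [ContinuousLinearEquiv.symm_apply_eq, he, Matrix.mulVec_mulVec,
      Matrix.mul_nonsing_inv _ hunit, Matrix.one_mulVec]
  set h : (Fin d → K) → (Fin d → K) := coordProjCLM τ ∘ f with hh
  obtain ⟨p, hp⟩ : AnalyticAt K h a := ((coordProjCLM τ).analyticAt _).comp hfan
  have hd : HasFDerivAt h (e : (Fin d → K) →L[K] (Fin d → K)) a := by
    have : (e : (Fin d → K) →L[K] (Fin d → K)) = (coordProjCLM τ).comp L := by
      ext1 w
      exact (he w).trans (hNL w)
    rw [this]
    exact (coordProjCLM τ).hasFDerivAt.comp a hfan.differentiableAt.hasFDerivAt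
  have hp1 : continuousMultilinearCurryFin1 K (Fin d → K) (Fin d → K) (p 1) = (e : (Fin d → K) →L[K] (Fin d → K)) :=
    hp.hasFDerivAt.unique hd
  have hs : HasStrictFDerivAt h (e : (Fin d → K) →L[K] (Fin d → K)) a := hp1 ▸ hp.hasStrictFDerivAt
  set R := hs.toOpenPartialHomeomorph h with hR
  have hRc : ∀ z, R z = h z := fun z => rfl
  have haR : a ∈ R.source := hs.mem_toOpenPartialHomeomorph_source
  have hsymm : AnalyticAt K R.symm (h a) :=
    (R.hasFPowerSeriesAt_symm haR hp (i := e)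
      (by rw [← hp1, LinearIsometryEquiv.symm_apply_apply])).analyticAt
  have hRa : R.symm (h a) = a := R.left_inv haR
  set b := h a with hb
  have hbτ : b = coordProj τ x₀ := by rw [hb, hh, Function.comp_apply, hfa]; rfl
  -- The same patch, parametrized by the coordinates τ. Its derivative at b is A N⁻¹, whose entries
  -- have norm at most one.
  set g := f ∘ R.symm with hg
  have hgan : AnalyticAt K g b := AnalyticAt.comp (by rw [hRa]; exact hfan) hsymm
  have hfg : f =ᶠ[𝓝 a] g ∘ h := by
    filter_upwards [R.open_source.mem_nhds haR] with z hz
    rw [hg, Function.comp_apply, Function.comp_apply, ← hRc, R.left_inv hz]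
  have hgd : HasStrictFDerivAt g (L.comp (e.symm : (Fin d → K) →L[K] (Fin d → K))) b := by
    have h1 := hgan.hasStrictFDerivAt
    have h2 := (h1.hasFDerivAt.comp a hd).congr_of_eventuallyEq hfg
    have h3 := h2.unique hfan.differentiableAt.hasFDerivAt
    have h4 : fderiv K g b = L.comp (e.symm : (Fin d → K) →L[K] (Fin d → K)) := by
      ext1 w
      have := DFunLike.congr_fun h3 (e.symm w)
      simpa using this
    rwa [h4] at h1
  have hGle : ∀ w, ‖L (e.symm w)‖ ≤ ‖w‖ := by
    intro w
    rw [hesymm, ← hAL, Matrix.mulVec_mulVec]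
    exact norm_mulVec_le_of_norm_le_one hle w
  -- Strict differentiability bounds the error by ‖q.1 - q.2‖, and the ultrametric inequality
  -- replaces the sum of error and linear part by a maximum. Thus the Lipschitz constant is exactly
  -- one; the reverse inequality holds for every coordinate projection.
  have hlip : ∀ᶠ q : (Fin d → K) × (Fin d → K) in 𝓝 (b, b), ‖g q.1 - g q.2‖ ≤ ‖q.1 - q.2‖ := by
    filter_upwards [hgd.isLittleO.bound one_pos] with q hq
    rw [one_mul] at hq
    have := IsUltrametricDist.norm_add_le_max
      (g q.1 - g q.2 - (L.comp (e.symm : (Fin d → K) →L[K] (Fin d → K))) (q.1 - q.2))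
      ((L.comp (e.symm : (Fin d → K) →L[K] (Fin d → K))) (q.1 - q.2))
    rw [sub_add_cancel] at this
    exact this.trans (max_le hq (hGle _))
  rw [nhds_prod_eq, eventually_prod_self_iff'] at hlip
  obtain ⟨T, hT, hTlip⟩ := hlip
  have hev : ∀ᶠ w in 𝓝 b, w ∈ T ∧ w ∈ R.target ∧ R.symm w ∈ U' ∧ AnalyticAt K g w := by
    have h1 : ∀ᶠ w in 𝓝 b, w ∈ R.target := R.open_target.mem_nhds (R.map_source haR)
    have h2 : ∀ᶠ w in 𝓝 b, R.symm w ∈ U' :=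
      hsymm.continuousAt.preimage_mem_nhds (hf.isOpen.mem_nhds (by rw [hRa]; exact ha))
    filter_upwards [hT, h1, h2, hgan.eventually_analyticAt] with w h1 h2 h3 h4
    exact ⟨h1, h2, h3, h4⟩
  obtain ⟨V', hV', hV'o, hbV'⟩ := _root_.eventually_nhds_iff.mp hev
  have hgp : ∀ x ∈ U, coordProj σ x ∈ R.source → g (coordProj τ x) = x := by
    intro x hx hxs
    have h1 : R (coordProj σ x) = coordProj τ x := by
      rw [hRc, hh, Function.comp_apply, hf.invOn.1 hx]; rfl
    rw [← h1, hg, Function.comp_apply, R.left_inv hxs, hf.invOn.1 hx]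
  have hpg : ∀ w ∈ V', coordProj τ (g w) = w := by
    intro w hw
    exact R.right_inv (hV' w hw).2.1
  set V := U ∩ coordProj σ ⁻¹' (R.source ∩ R ⁻¹' V') with hV
  have hVτ : ∀ x ∈ V, coordProj τ x ∈ V' := by
    rintro x ⟨hx, hxs, hxV⟩
    have h1 : R (coordProj σ x) = coordProj τ x := by
      rw [hRc, hh, Function.comp_apply, hf.invOn.1 hx]; rfl
    rw [← h1]; exact hxV
  have hgV : ∀ w ∈ V', g w ∈ V := by
    intro w hw
    obtain ⟨-, hwt, hwU, -⟩ := hV' w hw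
    have h1 : coordProj σ (g w) = R.symm w := hf.invOn.2 hwU
    refine ⟨hf.apply_mem hwU, ?_⟩
    rw [mem_preimage, h1]
    exact ⟨R.map_target hwt, by rw [mem_preimage, R.right_inv hwt]; exact hw⟩
  have hinv : InvOn g (coordProj τ) V V' := ⟨fun x hx => hgp x hx.1 hx.2.1, fun w hw => hpg w hw⟩
  refine ⟨V, τ, V', g, h, ⟨⟨?_, hV'o, ?_, hinv, fun w hw => (hV' w hw).2.2.2⟩, ?_⟩, ?_,
    hd.differentiableAt, hbτ, hfg⟩
  · obtain ⟨O, hO, hUO⟩ := hf.relOpen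
    refine ⟨O ∩ coordProj σ ⁻¹' (R.source ∩ R ⁻¹' V'),
      hO.inter ((R.isOpen_inter_preimage hV'o).preimage (continuous_coordProj σ)), ?_⟩
    rw [hV, hUO, inter_assoc]
  · exact hinv.bijOn hVτ hgV
  · intro x hx y hy
    refine le_antisymm (dist_coordProj_le τ x y) ?_
    have := hTlip _ (hV' _ (hVτ x hx)).1 _ (hV' _ (hVτ y hy)).1
    rwa [hinv.1 hx, hinv.1 hy, ← dist_eq_norm, ← dist_eq_norm] at this
  · exact ⟨hx₀, haR, hbV'⟩

end IsometricChart

end NonarchFourier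

namespace NonarchFourier

/-! ### Contractions do not increase Haar measure -/

section Lipschitz

variable {E : Type*} [NormedAddCommGroup E] [IsUltrametricDist E] [SecondCountableTopology E]
  [MeasurableSpace E] [BorelSpace E]

omit [SecondCountableTopology E] [IsUltrametricDist E] in
theorem measure_closedBall_eq (μ : Measure E) [μ.IsAddLeftInvariant] (x : E) (r : ℝ) :
    μ (Metric.closedBall x r) = μ (Metric.closedBall 0 r) := by
  rw [← measure_preimage_add μ (-x) (Metric.closedBall 0 r)]
  congr 1
  ext y
  rw [mem_preimage, mem_closedBall_zero_iff, Metric.mem_closedBall, dist_eq_norm]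
  congr! 2
  abel

/-- A map which does not increase distances does not increase a translation invariant measure on
an ultrametric group. -/
theorem measure_image_le_of_dist_le (μ : Measure E) [μ.IsAddLeftInvariant] [μ.OuterRegular]
    {φ : E → E} {B : Set E} (hφ : ∀ x ∈ B, ∀ y ∈ B, dist (φ x) (φ y) ≤ dist x y) :
    μ (φ '' B) ≤ μ B := by
  rw [Set.measure_eq_iInf_isOpen B μ]
  refine le_iInf fun O => le_iInf fun hBO => le_iInf fun hO => ?_
  -- The points whose ball of one fixed radius lies in `O`. Balls of equal radius coincide or are
  -- disjoint, so they cover `T m` inside `O` without overlap, and φ maps each piece into a ball of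
  -- the same radius, hence of the same measure.
  let T : ℕ → Set E := fun m => {x ∈ B | Metric.closedBall x (1 / (m + 1 : ℝ)) ⊆ O}
  have hTmono : Monotone T := by
    intro m l hml x hx
    refine ⟨hx.1, (Metric.closedBall_subset_closedBall ?_).trans hx.2⟩
    exact one_div_le_one_div_of_le (by positivity) (by gcongr)
  have hTU : B = ⋃ m, T m := by
    refine Subset.antisymm (fun x hx => ?_) (iUnion_subset fun m x hx => hx.1)
    obtain ⟨ε, hε, hεO⟩ := Metric.isOpen_iff.mp hO x (hBO hx)
    obtain ⟨m, hm⟩ := exists_nat_one_div_lt hε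
    exact mem_iUnion.mpr ⟨m, hx, (Metric.closedBall_subset_ball hm).trans hεO⟩
  rw [hTU, image_iUnion, Monotone.measure_iUnion fun m l hml => image_mono (hTmono hml)]
  refine iSup_le fun m => ?_
  set r : ℝ := 1 / (m + 1 : ℝ) with hr
  have hr0 : 0 < r := by positivity
  set 𝒞 : Set (Set E) := (fun x => Metric.closedBall x r) '' T m with h𝒞
  have hd : 𝒞.PairwiseDisjoint id := by
    rintro _ ⟨x, -, rfl⟩ _ ⟨y, -, rfl⟩ hne
    exact (IsUltrametricDist.closedBall_eq_or_disjoint x y r).resolve_left hne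
  have hc : 𝒞.Countable := by
    refine hd.countable_of_isOpen ?_ ?_
    · rintro _ ⟨x, -, rfl⟩
      exact IsUltrametricDist.isOpen_closedBall x hr0.ne'
    · rintro _ ⟨x, -, rfl⟩
      exact ⟨x, Metric.mem_closedBall_self hr0.le⟩
  have hcov : φ '' T m ⊆ ⋃ c ∈ 𝒞, φ '' (T m ∩ c) := by
    rintro _ ⟨x, hx, rfl⟩
    exact mem_biUnion (mem_image_of_mem _ hx) ⟨x, ⟨hx, Metric.mem_closedBall_self hr0.le⟩, rfl⟩
  calc μ (φ '' T m) ≤ ∑' c : 𝒞, μ (φ '' (T m ∩ c)) :=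
        (measure_mono hcov).trans (measure_biUnion_le μ hc _)
    _ ≤ ∑' c : 𝒞, μ (id c.1) := by
        refine ENNReal.tsum_le_tsum ?_
        rintro ⟨_, x, hx, rfl⟩
        have : φ '' (T m ∩ Metric.closedBall x r) ⊆ Metric.closedBall (φ x) r := by
          rintro _ ⟨y, ⟨hy, hyx⟩, rfl⟩
          exact (hφ y hy.1 x hx.1).trans hyx
        refine (measure_mono this).trans_eq ?_
        simp only [id]
        rw [measure_closedBall_eq, measure_closedBall_eq μ x]
    _ = μ (⋃ c ∈ 𝒞, id c) := by
        rw [measure_biUnion hc hd]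
        rintro _ ⟨x, -, rfl⟩
        exact measurableSet_closedBall
    _ ≤ μ O := by
        refine measure_mono (iUnion₂_subset ?_)
        rintro _ ⟨x, hx, rfl⟩
        exact hx.2

end Lipschitz

/-! ### The induced measure in isometric charts -/

section InducedMeasure

variable {K : Type*} [NontriviallyNormedField K] [IsUltrametricDist K] [LocallyCompactSpace K]
  [MeasurableSpace K] [BorelSpace K] {n d : ℕ}

instance isAddHaarMeasure_haar : (haar K d).IsAddHaarMeasure := by
  have : ProperSpace K := ProperSpace.of_locallyCompactSpace K
  unfold haar; infer_instance

/-- The transition map `coordProj τ ∘ f` does not increase distances, hence not Haar measure.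
Exchanging the charts gives equality on overlaps. -/
theorem map_restrict_apply_le {M U V : Set (Fin n → K)} {σ τ : Fin d ↪ Fin n}
    {U' V' : Set (Fin d → K)} {f g : (Fin d → K) → (Fin n → K)}
    (hf : IsIsometricChart M U σ U' f) (hg : IsIsometricChart M V τ V' g)
    {s : Set (Fin n → K)} (hs : MeasurableSet s) (hsU : s ⊆ U) :
    Measure.map g ((haar K d).restrict V') s ≤ Measure.map f ((haar K d).restrict U') s := by
  have : ProperSpace K := ProperSpace.of_locallyCompactSpace K
  rw [Measure.map_apply_of_aemeasurable
      (hg.analytic.continuousOn.aemeasurable hg.isOpen.measurableSet) hs,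
    Measure.map_apply_of_aemeasurable
      (hf.analytic.continuousOn.aemeasurable hf.isOpen.measurableSet) hs,
    Measure.restrict_apply' hg.isOpen.measurableSet, Measure.restrict_apply' hf.isOpen.measurableSet]
  have hsub : g ⁻¹' s ∩ V' ⊆ (fun w => coordProj τ (f w)) '' (f ⁻¹' s ∩ U') := by
    rintro z ⟨hz, hzV⟩
    have hgz : g z ∈ U := hsU hz
    refine ⟨coordProj σ (g z), ⟨?_, hf.toIsAnalyticChart.coordProj_mem hgz⟩, ?_⟩
    · rw [mem_preimage, hf.invOn.1 hgz]; exact hz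
    · change coordProj τ (f (coordProj σ (g z))) = z
      rw [hf.invOn.1 hgz, hg.invOn.2 hzV]
  refine (measure_mono hsub).trans (measure_image_le_of_dist_le _ ?_)
  rintro w ⟨-, hw⟩ w' ⟨-, hw'⟩
  refine (dist_coordProj_le τ _ _).trans ?_
  rw [← hf.isometry _ (hf.toIsAnalyticChart.apply_mem hw) _ (hf.toIsAnalyticChart.apply_mem hw'),
    hf.invOn.2 hw, hf.invOn.2 hw']

/-- On an isometric coordinate patch the induced measure is the transported Haar measure. -/
theorem inducedMeasure_restrict {M U : Set (Fin n → K)} {σ : Fin d ↪ Fin n}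
    {U' : Set (Fin d → K)} {f : (Fin d → K) → (Fin n → K)}
    (hf : IsIsometricChart M U σ U' f) (hU : MeasurableSet U) :
    (inducedMeasure d M).restrict U = Measure.map f ((haar K d).restrict U') := by
  have : ProperSpace K := ProperSpace.of_locallyCompactSpace K
  have hsupp : (Measure.map f ((haar K d).restrict U')).restrict U =
      Measure.map f ((haar K d).restrict U') := by
    refine Measure.restrict_eq_self_of_ae_mem ?_
    rw [ae_iff]
    change Measure.map f ((haar K d).restrict U') Uᶜ = 0
    rw [Measure.map_apply_of_aemeasurable
      (hf.analytic.continuousOn.aemeasurable hf.isOpen.measurableSet) hU.compl,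
      Measure.restrict_apply' hf.isOpen.measurableSet]
    convert measure_empty (μ := haar K d)
    refine eq_empty_of_forall_notMem ?_
    rintro z ⟨hz, hzU⟩
    exact hz (hf.toIsAnalyticChart.apply_mem hzU)
  refine le_antisymm ?_ ?_
  -- Each measure in the supremum is bounded inside U by comparison of charts, and outside U by the
  -- supremum itself. Restriction to U removes the second part.
  · have hle : inducedMeasure d M ≤
        Measure.map f ((haar K d).restrict U') + (inducedMeasure d M).restrict Uᶜ := by
      conv_lhs => unfold inducedMeasure
      refine iSup_le fun V => iSup_le fun τ => iSup_le fun V' => iSup_le fun g => iSup_le fun hg => ?_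
      refine Measure.le_iff.mpr fun s hs => ?_
      rw [← measure_inter_add_sdiff s hU, Measure.add_apply, Measure.restrict_apply hs]
      refine add_le_add ?_ ?_
      · exact (map_restrict_apply_le hf hg (hs.inter hU) inter_subset_right).trans
          (measure_mono inter_subset_left)
      · refine Measure.le_iff.mp ?_ _ (hs.diff hU)
        unfold inducedMeasure
        exact le_iSup_of_le V <| le_iSup_of_le τ <| le_iSup_of_le V' <| le_iSup_of_le g <|
          le_iSup_of_le hg le_rfl
    have := Measure.restrict_mono_measure hle U
    rwa [Measure.restrict_add, hsupp, Measure.restrict_restrict hU, inter_compl_self,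
      Measure.restrict_empty, add_zero] at this
  · rw [← hsupp]
    refine Measure.restrict_mono_measure ?_ U
    unfold inducedMeasure
    exact le_iSup_of_le U <| le_iSup_of_le σ <| le_iSup_of_le U' <| le_iSup_of_le f <|
      le_iSup_of_le hf le_rfl

end InducedMeasure

end NonarchFourier

namespace NonarchFourier

/-! ### Uniform bounds for re-expanded power series -/

section ChangeOrigin

open scoped NNReal ENNReal

variable {K : Type*} [NontriviallyNormedField K]
  {E F : Type*} [NormedAddCommGroup E] [NormedSpace K E] [NormedAddCommGroup F] [NormedSpace K F]

/-- Uniform bounds on the coefficients of the expansions at nearby points. -/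
theorem exists_norm_changeOrigin_le (p : FormalMultilinearSeries K E F) {R : ℝ≥0}
    (hR : 0 < R) (hp : (R + R : ℝ≥0∞) < p.radius) :
    ∃ C : ℝ, 0 ≤ C ∧ ∀ z : E, ‖z‖ ≤ R → ∀ i, ‖p.changeOrigin z i‖ ≤ C / R ^ i := by
  have hsum := p.changeOriginSeries_summable_aux₁ hp
  -- The total sum over all orders dominates each slice k = i, so the constant depends neither on i
  -- nor on z.
  refine ⟨(∑' s : Σ k l : ℕ, { s : Finset (Fin (k + l)) // s.card = l },
    ‖p (s.1 + s.2.1)‖₊ * R ^ s.2.1 * R ^ s.1 : ℝ≥0), NNReal.coe_nonneg _, fun z hz i => ?_⟩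
  have hz' : ‖z‖₊ ≤ R := hz
  have hRlt : (R : ℝ≥0∞) < p.radius := lt_of_le_of_lt (self_le_add_right _ _) hp
  have h1 := p.nnnorm_changeOrigin_le i (lt_of_le_of_lt (ENNReal.coe_le_coe.mpr hz') hRlt)
  have h2 : (∑' s : Σ l : ℕ, { s : Finset (Fin (i + l)) // s.card = l },
      ‖p (i + s.1)‖₊ * ‖z‖₊ ^ s.1) ≤
      ∑' s : Σ l : ℕ, { s : Finset (Fin (i + l)) // s.card = l }, ‖p (i + s.1)‖₊ * R ^ s.1 := by
    refine Summable.tsum_le_tsum (fun s => by gcongr)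
      (NNReal.summable_of_le (fun s => ?_) (p.changeOriginSeries_summable_aux₂ hRlt i))
      (p.changeOriginSeries_summable_aux₂ hRlt i)
    gcongr
  have h3 : (∑' s : Σ l : ℕ, { s : Finset (Fin (i + l)) // s.card = l }, ‖p (i + s.1)‖₊ * R ^ s.1)
      * R ^ i ≤ ∑' s : Σ k l : ℕ, { s : Finset (Fin (k + l)) // s.card = l },
        ‖p (s.1 + s.2.1)‖₊ * R ^ s.2.1 * R ^ s.1 := by
    rw [← NNReal.tsum_mul_right]
    exact NNReal.tsum_comp_le_tsum_of_inj hsum (i := Sigma.mk i) sigma_mk_injective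
  have h4 : ‖p.changeOrigin z i‖₊ * R ^ i ≤ ∑' s : Σ k l : ℕ,
      { s : Finset (Fin (k + l)) // s.card = l }, ‖p (s.1 + s.2.1)‖₊ * R ^ s.2.1 * R ^ s.1 :=
    (mul_le_mul_left (h1.trans h2) _).trans h3
  rw [le_div_iff₀ (by positivity)]
  exact_mod_cast h4

end ChangeOrigin

/-! ### Decay over small balls in a chart -/

section Local

open Polynomial in
/-- Van der Corput's lemma for power series in one variable. -/
theorem exists_norm_integral_addChar_hasSum_le {K : Type*} [NontriviallyNormedField K]
    [IsUltrametricDist K] [LocallyCompactSpace K] [MeasurableSpace K] [BorelSpace K]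
    {ψ : AddChar K Circle} (hK : IsNormalizedNorm K)
    (hψ : ∀ x : K, ‖x‖ < 1 → ψ x = 1) (hψ' : ∃ x : K, ‖x‖ ≤ 1 ∧ ψ x ≠ 1) (k : ℕ)
    (hk : ∀ i : ℕ, 1 ≤ i → i ≤ k → (i : K) ≠ 0) :
    ∃ ε : ℝ, 0 < ε ∧ ∀ j, 1 ≤ j → j ≤ k → ∃ C : ℝ, 0 ≤ C ∧ ∀ (c : ℕ → K) (F : K → K),
      c j ≠ 0 → (∀ i, j < i → ‖c i‖ ≤ ε * ‖c j‖) → Tendsto c atTop (𝓝 0) →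
      (∀ u : K, ‖u‖ ≤ 1 → HasSum (fun i => c i * u ^ i) (F u)) →
      ‖∫ u in Metric.closedBall (0 : K) 1, (ψ (F u) : ℂ)
        ∂(Measure.addHaarMeasure (unitBall K))‖ ≤ C * ‖c j‖ ^ (-(1 : ℝ) / j) := by
  obtain ⟨ε, hε, h⟩ := exists_norm_integral_addChar_eval_le hK hψ hψ' k hk
  refine ⟨ε, hε, fun j hj hjk => ?_⟩
  obtain ⟨C, hC, h⟩ := h j hj hjk
  refine ⟨C, hC, fun c F hcj hc hlim hF => ?_⟩
  -- Any threshold below 1 would do: the discarded tail lies in the maximal ideal, which ψ ignores.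
  -- Also N > j, so that the coefficient j survives.
  have hev := hlim.norm.eventually (eventually_le_nhds (b := (1 / 2 : ℝ)) (by simp))
  obtain ⟨N, hN⟩ := (hev.and (eventually_gt_atTop j)).exists_forall_of_atTop
  have hjN : j < N := (hN N le_rfl).2
  set P : K[X] := ∑ i ∈ Finset.range N, monomial i (c i) with hP
  have hcoeff : ∀ i, P.coeff i = if i < N then c i else 0 := by
    intro i
    rw [hP, finsetSum_coeff]
    simp [coeff_monomial]
  have hPj : P.coeff j = c j := by rw [hcoeff, if_pos hjN]
  have key : ∀ u ∈ Metric.closedBall (0 : K) 1, (ψ (F u) : ℂ) = (ψ (P.eval u) : ℂ) := by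
    intro u hu
    rw [mem_closedBall_zero_iff] at hu
    have h1 := (hasSum_nat_add_iff' N).mpr (hF u hu)
    have h2 : P.eval u = ∑ i ∈ Finset.range N, c i * u ^ i := by
      rw [hP, eval_finsetSum]; simp
    have h3 : ‖F u - P.eval u‖ ≤ 1 / 2 := by
      rw [h2]
      refine le_of_tendsto h1.norm (Eventually.of_forall fun s => ?_)
      refine IsUltrametricDist.norm_sum_le_of_forall_le_of_nonneg (by norm_num) fun i _ => ?_
      rw [norm_mul, norm_pow]
      exact (mul_le_of_le_one_right (norm_nonneg _) (pow_le_one₀ (norm_nonneg _) hu)).trans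
        (hN _ (by omega)).1
    have h4 := addChar_add_eq_of_norm_lt_one hψ (P.eval u) (h3.trans_lt (by norm_num))
    rw [add_sub_cancel] at h4
    rw [h4]
  rw [setIntegral_congr_fun measurableSet_closedBall key, ← hPj]
  refine h P (by rwa [hPj]) fun i hi => ?_
  rw [hPj, hcoeff]
  split_ifs
  · exact hc i hi
  · rw [norm_zero]; positivity

theorem norm_dotProduct_le {K : Type*} [NontriviallyNormedField K] [IsUltrametricDist K] {n : ℕ}
    (v w : Fin n → K) : ‖v ⬝ᵥ w‖ ≤ ‖v‖ * ‖w‖ := by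
  rw [dotProduct]
  refine IsUltrametricDist.norm_sum_le_of_forall_le_of_nonneg (by positivity) fun i _ => ?_
  rw [norm_mul]
  gcongr
  · exact norm_le_pi_norm v i
  · exact norm_le_pi_norm w i

/-- Decay of exponent 1/m, obtained from a term of degree m ≤ k, is at least as good as 1/k because
y ≥ 1. -/
theorem rpow_neg_one_div_le {x y : ℝ} (hx : 0 < x) (hy : 1 ≤ y) {m k : ℕ} (hm : 1 ≤ m)
    (hmk : m ≤ k) :
    (y * x) ^ (-(1 : ℝ) / m) ≤ x ^ (-(1 : ℝ) / m) * y ^ (-(1 : ℝ) / k) := by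
  rw [mul_comm y, Real.mul_rpow hx.le (by positivity)]
  refine mul_le_mul_of_nonneg_left ?_ (by positivity)
  have hm' : (0 : ℝ) < m := by exact_mod_cast hm
  have : (m : ℝ) ≤ k := by exact_mod_cast hmk
  refine Real.rpow_le_rpow_of_exponent_le hy ?_
  rw [neg_div, neg_div, neg_le_neg_iff]
  exact one_div_le_one_div_of_le hm' this

variable {K : Type*} [NontriviallyNormedField K] [IsUltrametricDist K] [LocallyCompactSpace K]
  [MeasurableSpace K] [BorelSpace K] {n d : ℕ} {ψ : AddChar K Circle}

/-- Decay of the oscillatory integral over small balls, for frequencies in a small cone. -/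
theorem exists_decay_near_direction (hK : IsNormalizedNorm K)
    (hψ : ∀ x : K, ‖x‖ < 1 → ψ x = 1) (hψ' : ∃ x : K, ‖x‖ ≤ 1 ∧ ψ x ≠ 1) {k : ℕ}
    (hk : ∀ i : ℕ, 1 ≤ i → i ≤ k → (i : K) ≠ 0)
    {g : (Fin d → K) → (Fin n → K)} {b : Fin d → K} (hg : AnalyticAt K g b) {v₀ : Fin n → K}
    (hv₀ : ∀ p : FormalMultilinearSeries K (Fin d → K) (Fin n → K), HasFPowerSeriesAt g p b →
      ∃ m, 1 ≤ m ∧ m ≤ k ∧ ∃ y, v₀ ⬝ᵥ (p m fun _ => y) ≠ 0) :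
    ∃ N ∈ 𝓝 v₀, ∃ ρ : ℝ, 0 < ρ ∧ ∀ r, 0 < r → r ≤ ρ → ∃ C : ℝ, ∀ v ∈ N, ‖v‖ = 1 →
      ∀ c : K, 1 ≤ ‖c‖ →
      ‖∫ x in Metric.closedBall b r, (ψ ((c • v) ⬝ᵥ g x) : ℂ) ∂(haar K d)‖ ≤
        C * ‖c‖ ^ (-(1 : ℝ) / k) := by
  have : ProperSpace K := ProperSpace.of_locallyCompactSpace K
  obtain ⟨p, R₀, hp⟩ := hg
  obtain ⟨R, hR0, hRR⟩ : ∃ R : NNReal, 0 < R ∧ (R + R : ENNReal) < R₀ := by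
    obtain ⟨R, hR0, hR⟩ := ENNReal.lt_iff_exists_nnreal_btwn.mp hp.r_pos
    refine ⟨R / 2, by simpa using hR0, ?_⟩
    rw [← ENNReal.coe_add, add_halves]; exact hR
  have hRrad : (R + R : ENNReal) < p.radius := hRR.trans_le hp.r_le
  have hRlt : (R : ENNReal) < R₀ := lt_of_le_of_lt (self_le_add_right _ _) hRR
  obtain ⟨C₀, hC₀, hbound⟩ := exists_norm_changeOrigin_le p hR0 hRrad
  have hRpos : (0 : ℝ) < R := hR0
  have hexp : ∀ z : Fin d → K, ‖z‖ ≤ R →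
      HasFPowerSeriesOnBall g (p.changeOrigin z) (b + z) (R₀ - ‖z‖₊) := fun z hz =>
    hp.changeOrigin (lt_of_le_of_lt (ENNReal.coe_le_coe.mpr hz) hRlt)
  -- The condition is applied to `p.changeOrigin 0` instead of `p`, so that the nonzero term is the
  -- value at z = 0 of the continuous family `p.changeOrigin z m`.
  obtain ⟨m, hm, hmk, y₀, hy₀⟩ := hv₀ (p.changeOrigin 0)
    ⟨_, by simpa using hexp 0 (by simp)⟩
  obtain ⟨t, ht0, ht⟩ := NormedField.exists_norm_lt K (show 0 < 1 / (‖y₀‖ + 1) by positivity)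
  set ξ := t • y₀ with hξdef
  have hξ1 : ‖ξ‖ ≤ 1 := by
    rw [hξdef, norm_smul]
    calc ‖t‖ * ‖y₀‖ ≤ 1 / (‖y₀‖ + 1) * (‖y₀‖ + 1) := by gcongr; linarith
      _ = 1 := by field_simp
  have hξ : v₀ ⬝ᵥ (p.changeOrigin 0 m fun _ => ξ) ≠ 0 := by
    have : (p.changeOrigin 0 m fun _ => ξ) = t ^ m • (p.changeOrigin 0 m fun _ => y₀) := by
      rw [hξdef]
      simpa using (p.changeOrigin 0 m).map_smul_univ (fun _ => t) (fun _ => y₀)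
    rw [this, dotProduct_smul]
    exact smul_ne_zero (pow_ne_zero _ (norm_pos_iff.mp ht0)) hy₀
  have hcont : ContinuousAt (fun q : (Fin d → K) × (Fin n → K) =>
      ‖q.2 ⬝ᵥ (p.changeOrigin q.1 m fun _ => ξ)‖) (0, v₀) := by
    have hc0 : ContinuousAt (fun z => p.changeOrigin z m) 0 :=
      (p.analyticAt_changeOrigin (hp.r_pos.trans_le hp.r_le) m).continuousAt
    have hc1 : ContinuousAt (fun q : (Fin d → K) × (Fin n → K) =>
        p.changeOrigin q.1 m fun _ => ξ) (0, v₀) :=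
      (ContinuousMultilinearMap.apply K (fun _ : Fin m => Fin d → K) (Fin n → K)
        (fun _ => ξ)).continuous.continuousAt.comp
        (hc0.comp_of_eq (continuousAt_fst (p := ((0 : Fin d → K), v₀))) rfl)
    refine ContinuousAt.norm ?_
    simp only [dotProduct]
    refine tendsto_finsetSum _ fun i _ => ?_
    refine ContinuousAt.mul ?_ ?_
    · exact ((continuous_apply i).comp continuous_snd).continuousAt
    · exact (continuous_apply i).continuousAt.comp hc1
  obtain ⟨c₀, hc₀, hc₀lt⟩ := exists_between (norm_pos_iff.mpr hξ)
  have hev := hcont.eventually (eventually_ge_nhds hc₀lt)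
  rw [nhds_prod_eq] at hev
  obtain ⟨pa, hpa, N, hN, hlow⟩ := eventually_prod_iff.mp hev
  obtain ⟨δ, hδ, hδpa⟩ := Metric.nhds_basis_closedBall.eventually_iff.mp hpa
  obtain ⟨ε, hε, hvdc⟩ := exists_norm_integral_addChar_hasSum_le hK hψ hψ' k hk
  obtain ⟨C, hC, hvdc⟩ := hvdc m hm hmk
  refine ⟨{v | N v}, hN, min δ R, lt_min hδ hRpos, fun r hr hrρ => ?_⟩
  have hrδ : r ≤ δ := hrρ.trans (min_le_left _ _)
  have hrR : r ≤ R := hrρ.trans (min_le_right _ _)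
  -- Along x + u s ξ the coefficients are c a_i s^i with |a_i| ≤ C₀ / R^i and |a_m| ≥ c₀. The last
  -- bound on |s| makes the m-th dominate the higher ones by ε; |s| < r keeps the segments in the
  -- ball, and |s| < R gives convergence.
  obtain ⟨s, hs0, hs⟩ := NormedField.exists_norm_lt K
    (show 0 < min r (min (R : ℝ) (ε * c₀ * R ^ (m + 1) / (C₀ + 1))) by positivity)
  have hsr : ‖s‖ < r := hs.trans_le (min_le_left _ _)
  have hsR : ‖s‖ < R := hs.trans_le ((min_le_right _ _).trans (min_le_left _ _))
  have hsε : C₀ * ‖s‖ ≤ ε * c₀ * R ^ (m + 1) := by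
    have h1 := hs.trans_le ((min_le_right _ _).trans (min_le_right _ _))
    rw [lt_div_iff₀ (by positivity)] at h1
    nlinarith
  have hcs : 0 < c₀ * ‖s‖ ^ m := by positivity
  refine ⟨C * (c₀ * ‖s‖ ^ m) ^ (-(1 : ℝ) / m) * (haar K d).real (Metric.closedBall b r),
    fun v hv hv1 c hc => ?_⟩
  have hc0 : 0 < ‖c‖ := one_pos.trans_le hc
  refine (norm_setIntegral_le_of_translates (K := K) (haar K d) (isCompact_closedBall b r)
    (s • ξ) ?_ ?_ (b := C * ((c₀ * ‖s‖ ^ m) ^ (-(1 : ℝ) / m) * ‖c‖ ^ (-(1 : ℝ) / k))) ?_).trans_eq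
    (by ring)
  · intro u hu x hx
    rw [Metric.mem_closedBall, dist_eq_norm] at hx ⊢
    rw [add_sub_right_comm]
    refine (IsUltrametricDist.norm_add_le_max _ _).trans (max_le hx ?_)
    rw [norm_smul, norm_smul]
    calc ‖u‖ * (‖s‖ * ‖ξ‖) ≤ 1 * (r * 1) := by gcongr
      _ = r := by ring
  · have hgc : ContinuousOn g (Metric.closedBall b r) := by
      refine hp.continuousOn.mono fun x hx => ?_
      rw [Metric.mem_closedBall, dist_eq_norm] at hx
      rw [Metric.mem_eball, edist_eq_enorm_sub]
      have : ‖x - b‖₊ ≤ R := hx.trans hrR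
      exact lt_of_le_of_lt (ENNReal.coe_le_coe.mpr this) hRlt
    have hdot : ContinuousOn (fun x => (c • v) ⬝ᵥ g x) (Metric.closedBall b r) := by
      simp only [← dotCLM_apply]
      exact (dotCLM (c • v)).continuous.comp_continuousOn hgc
    exact continuous_subtype_val.comp_continuousOn ((continuous_addChar hψ).comp_continuousOn hdot)
  · intro x hx
    rw [Metric.mem_closedBall, dist_eq_norm] at hx
    set z := x - b with hz
    have hzR : ‖z‖ ≤ R := hx.trans hrR
    have hxz : b + z = x := by rw [hz]; abel
    have hx' := hexp z hzR
    rw [hxz] at hx'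
    let a : ℕ → K := fun i => v ⬝ᵥ (p.changeOrigin z i fun _ => ξ)
    have ha : ∀ i, ‖a i‖ ≤ C₀ / R ^ i := by
      intro i
      refine (norm_dotProduct_le _ _).trans ?_
      rw [hv1, one_mul]
      refine ((p.changeOrigin z i).le_opNorm _).trans ?_
      rw [Finset.prod_const]
      exact (mul_le_of_le_one_right (norm_nonneg _) (pow_le_one₀ (norm_nonneg _) hξ1)).trans
        (hbound z hzR i)
    have ham : c₀ ≤ ‖a m‖ := by
      refine hlow (hδpa ?_) hv
      rw [mem_closedBall_zero_iff]
      exact hx.trans hrδ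
    let f : ℕ → K := fun i => c * a i * s ^ i
    have hf : ∀ i, ‖f i‖ ≤ ‖c‖ * C₀ * (‖s‖ / R) ^ i := by
      intro i
      simp only [f]
      rw [norm_mul, norm_mul, norm_pow, div_pow]
      calc ‖c‖ * ‖a i‖ * ‖s‖ ^ i ≤ ‖c‖ * (C₀ / R ^ i) * ‖s‖ ^ i := by gcongr; exact ha i
        _ = _ := by ring
    have hfm : ‖c‖ * (c₀ * ‖s‖ ^ m) ≤ ‖f m‖ := by
      simp only [f]
      rw [norm_mul, norm_mul, norm_pow, mul_assoc]
      gcongr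
    have hfm0 : 0 < ‖f m‖ := lt_of_lt_of_le (by positivity) hfm
    have hsR1 : ‖s‖ / R < 1 := (div_lt_one hRpos).mpr hsR
    refine (hvdc f (fun u => (c • v) ⬝ᵥ g (x + u • s • ξ)) (norm_pos_iff.mp hfm0) ?_ ?_ ?_).trans ?_
    · intro i hi
      refine (hf i).trans (le_trans ?_ (mul_le_mul_of_nonneg_left hfm hε.le))
      calc ‖c‖ * C₀ * (‖s‖ / R) ^ i ≤ ‖c‖ * C₀ * (‖s‖ / R) ^ (m + 1) := by
            gcongr ?_ * ?_
            exact pow_le_pow_of_le_one (by positivity) hsR1.le hi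
        _ = ‖c‖ * (C₀ * ‖s‖) * ‖s‖ ^ m / R ^ (m + 1) := by rw [div_pow, pow_succ ‖s‖]; ring
        _ ≤ ‖c‖ * (ε * c₀ * R ^ (m + 1)) * ‖s‖ ^ m / R ^ (m + 1) := by gcongr
        _ = ε * (‖c‖ * (c₀ * ‖s‖ ^ m)) := by field_simp
    · refine squeeze_zero_norm hf ?_
      simpa using (tendsto_pow_atTop_nhds_zero_of_lt_one (by positivity) hsR1).const_mul (‖c‖ * C₀)
    · intro u hu
      have hw : u • s • ξ ∈ Metric.eball (0 : Fin d → K) (R₀ - ‖z‖₊) := by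
        rw [mem_eball_zero_iff, lt_tsub_iff_right]
        refine lt_of_le_of_lt ?_ hRR
        have h1 : ‖u • s • ξ‖₊ ≤ R := by
          have : ‖u • s • ξ‖ ≤ R := by
            rw [norm_smul, norm_smul]
            calc ‖u‖ * (‖s‖ * ‖ξ‖) ≤ 1 * (R * 1) := by gcongr
              _ = R := by ring
          exact this
        exact add_le_add (ENNReal.coe_le_coe.mpr h1) (ENNReal.coe_le_coe.mpr hzR)
      have h1 := (dotCLM (c • v)).hasSum (hx'.hasSum hw)
      simp only [dotCLM_apply] at h1
      refine h1.congr_fun fun i => ?_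
      have h2 : (p.changeOrigin z i fun _ => u • s • ξ) =
          (u ^ i * s ^ i) • (p.changeOrigin z i fun _ => ξ) := by
        have := (p.changeOrigin z i).map_smul_univ (fun _ => u * s) (fun _ => ξ)
        simpa [mul_smul, mul_pow] using this
      simp only [f, a]
      refine Eq.trans ?_ (congrArg (fun t => (c • v) ⬝ᵥ t) h2).symm
      simp only [dotProduct_smul, smul_dotProduct, smul_eq_mul]
      ring
    · gcongr
      refine le_trans (Real.rpow_le_rpow_of_nonpos (by positivity) hfm ?_)
        (rpow_neg_one_div_le hcs hc hm hmk)
      rw [neg_div]; exact neg_nonpos.mpr (by positivity)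

/-- Decay of the oscillatory integral over small balls. -/
theorem exists_decay_near_point (hK : IsNormalizedNorm K)
    (hψ : ∀ x : K, ‖x‖ < 1 → ψ x = 1) (hψ' : ∃ x : K, ‖x‖ ≤ 1 ∧ ψ x ≠ 1) {k : ℕ}
    (hk : ∀ i : ℕ, 1 ≤ i → i ≤ k → (i : K) ≠ 0)
    {g : (Fin d → K) → (Fin n → K)} {b : Fin d → K} (hg : AnalyticAt K g b)
    (hgv : ∀ v ≠ 0, ∀ p : FormalMultilinearSeries K (Fin d → K) (Fin n → K), HasFPowerSeriesAt g p b →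
      ∃ m, 1 ≤ m ∧ m ≤ k ∧ ∃ y, v ⬝ᵥ (p m fun _ => y) ≠ 0) :
    ∃ ρ : ℝ, 0 < ρ ∧ ∀ r, 0 < r → r ≤ ρ → ∃ C : ℝ, ∀ y : Fin n → K, 1 ≤ ‖y‖ →
      ‖∫ x in Metric.closedBall b r, (ψ (y ⬝ᵥ g x) : ℂ) ∂(haar K d)‖ ≤
        C * ‖y‖ ^ (-(1 : ℝ) / k) := by
  have : ProperSpace K := ProperSpace.of_locallyCompactSpace K
  -- The admissible radius depends on the cone of directions. Allowing every r ≤ ρ lets finitely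
  -- many cones share one ball.
  have hcomp : ∃ ρ : ℝ, 0 < ρ ∧ ∀ r, 0 < r → r ≤ ρ → ∃ C : ℝ,
      ∀ v ∈ Metric.sphere (0 : Fin n → K) 1, ‖v‖ = 1 → ∀ c : K, 1 ≤ ‖c‖ →
      ‖∫ x in Metric.closedBall b r, (ψ ((c • v) ⬝ᵥ g x) : ℂ) ∂(haar K d)‖ ≤
        C * ‖c‖ ^ (-(1 : ℝ) / k) := by
    refine (isCompact_sphere (0 : Fin n → K) 1).induction_on
      (p := fun T => ∃ ρ : ℝ, 0 < ρ ∧ ∀ r, 0 < r → r ≤ ρ → ∃ C : ℝ,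
      ∀ v ∈ T, ‖v‖ = 1 → ∀ c : K, 1 ≤ ‖c‖ →
      ‖∫ x in Metric.closedBall b r, (ψ ((c • v) ⬝ᵥ g x) : ℂ) ∂(haar K d)‖ ≤
        C * ‖c‖ ^ (-(1 : ℝ) / k)) ⟨1, one_pos, fun r _ _ => ⟨0, by simp⟩⟩ ?_ ?_ ?_
    · rintro s t hst ⟨ρ, hρ, h⟩
      refine ⟨ρ, hρ, fun r hr hrρ => ?_⟩
      obtain ⟨C, hC⟩ := h r hr hrρ
      exact ⟨C, fun v hv => hC v (hst hv)⟩
    · rintro s t ⟨ρ, hρ, h⟩ ⟨ρ', hρ', h'⟩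
      refine ⟨min ρ ρ', lt_min hρ hρ', fun r hr hrρ => ?_⟩
      obtain ⟨C, hC⟩ := h r hr (hrρ.trans (min_le_left _ _))
      obtain ⟨C', hC'⟩ := h' r hr (hrρ.trans (min_le_right _ _))
      refine ⟨max C C', ?_⟩
      rintro v (hv | hv) hv1 c hc
      · exact (hC v hv hv1 c hc).trans (by gcongr; exact le_max_left _ _)
      · exact (hC' v hv hv1 c hc).trans (by gcongr; exact le_max_right _ _)
    · intro v hv
      have hv0 : v ≠ 0 := by rintro rfl; simp at hv
      obtain ⟨N, hN, h⟩ := exists_decay_near_direction hK hψ hψ' hk hg (hgv v hv0)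
      exact ⟨N, mem_nhdsWithin_of_mem_nhds hN, h⟩
  obtain ⟨ρ, hρ, h⟩ := hcomp
  refine ⟨ρ, hρ, fun r hr hrρ => ?_⟩
  obtain ⟨C, hC⟩ := h r hr hrρ
  refine ⟨C, fun y hy => ?_⟩
  obtain ⟨c, w, -, hcy, hw, rfl⟩ := exists_smul_eq_of_ne_zero
    (norm_pos_iff.mp (one_pos.trans_le hy))
  rw [← hcy] at hy ⊢
  exact hC w (by simpa using hw) hw c hy

end Local

end NonarchFourier

namespace NonarchFourier

/-! ### Gluing the local estimates -/

section Gluing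

/-- Ultrametric balls are nested or disjoint, and a minimal finite subcover contains no nested pair.
-/
theorem IsCompact.exists_finset_disjoint_closedBall {X : Type*} [MetricSpace X]
    [IsUltrametricDist X] {S : Set X} (hS : IsCompact S) (r : X → ℝ) (hr : ∀ x ∈ S, 0 < r x) :
    ∃ t : Finset X, (∀ x ∈ t, x ∈ S) ∧ S ⊆ ⋃ x ∈ t, Metric.closedBall x (r x) ∧
      (t : Set X).Pairwise fun x y =>
        Disjoint (Metric.closedBall x (r x)) (Metric.closedBall y (r y)) := by
  classical
  obtain ⟨t₀, ht₀, hcov₀⟩ := hS.elim_nhds_subcover (fun x => Metric.closedBall x (r x))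
    fun x hx => Metric.closedBall_mem_nhds x (hr x hx)
  obtain ⟨t, htt₀, ht⟩ := exists_minimal_le_of_wellFoundedLT
    (fun t : Finset X => S ⊆ ⋃ x ∈ t, Metric.closedBall x (r x)) t₀ hcov₀
  have key : ∀ x ∈ t, ∀ y ∈ t, x ≠ y →
      ¬ Metric.closedBall x (r x) ⊆ Metric.closedBall y (r y) := by
    intro x hx y hy hxy hsub
    have hcov : S ⊆ ⋃ z ∈ t.erase x, Metric.closedBall z (r z) := by
      intro z hz
      obtain ⟨w, hw, hzw⟩ := mem_iUnion₂.mp (ht.prop hz)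
      rcases eq_or_ne w x with rfl | hwx
      · exact mem_iUnion₂.mpr ⟨y, Finset.mem_erase.mpr ⟨hxy.symm, hy⟩, hsub hzw⟩
      · exact mem_iUnion₂.mpr ⟨w, Finset.mem_erase.mpr ⟨hwx, hw⟩, hzw⟩
    exact absurd (ht.le_of_le hcov (Finset.erase_subset x t) hx) (Finset.notMem_erase x t)
  refine ⟨t, fun x hx => ht₀ x (htt₀ hx), ht.prop, fun x hx y hy hxy => ?_⟩
  rcases IsUltrametricDist.closedBall_subset_trichotomy (x := x) (y := y) (r := r x) (s := r y)
    with h | h | h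
  · exact absurd h (key x hx y hy hxy)
  · exact absurd h (key y hy x hx hxy.symm)
  · exact h

variable {K : Type*} [NontriviallyNormedField K] [IsUltrametricDist K] [LocallyCompactSpace K]
  [MeasurableSpace K] [BorelSpace K] {n d : ℕ} {ψ : AddChar K Circle}

omit [IsUltrametricDist K] [LocallyCompactSpace K] [MeasurableSpace K] [BorelSpace K] in
theorem continuous_addChar_dotProduct (hψ : ∀ x : K, ‖x‖ < 1 → ψ x = 1) (y : Fin n → K) :
    Continuous fun x : Fin n → K => (ψ (y ⬝ᵥ x) : ℂ) := by
  refine continuous_subtype_val.comp ((continuous_addChar hψ).comp ?_)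
  exact (dotCLM y).continuous.congr (dotCLM_apply y)

/-- Decay of the Fourier transform of a small ball around a point of type at most `k`. -/
theorem HasTypeLEAt.exists_decay (hK : IsNormalizedNorm K)
    (hψ : ∀ x : K, ‖x‖ < 1 → ψ x = 1) (hψ' : ∃ x : K, ‖x‖ ≤ 1 ∧ ψ x ≠ 1) {k : ℕ}
    (hk : ∀ i : ℕ, 1 ≤ i → i ≤ k → (i : K) ≠ 0) {S : Set (Fin n → K)} (hS : MeasurableSet S)
    {x₀ : Fin n → K} (h : HasTypeLEAt d S k x₀) :
    ∃ r : ℝ, 0 < r ∧ inducedMeasure d S (S ∩ Metric.closedBall x₀ r) < ⊤ ∧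
      ∃ C : ℝ, ∀ y : Fin n → K, 1 ≤ ‖y‖ →
      ‖∫ x in S ∩ Metric.closedBall x₀ r, (ψ (y ⬝ᵥ x) : ℂ) ∂(inducedMeasure d S)‖ ≤
        C * ‖y‖ ^ (-(1 : ℝ) / k) := by
  have : ProperSpace K := ProperSpace.of_locallyCompactSpace K
  obtain ⟨U, σ, U', f, hf, hxU, hv⟩ := h
  obtain ⟨V, τ, V', g, φ, hg, hxV, hφ, hφb, hfg⟩ := hf.exists_isIsometricChart hxU
  set b := coordProj τ x₀ with hb
  have hbV : b ∈ V' := hg.toIsAnalyticChart.coordProj_mem hxV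
  have hgb : g b = x₀ := hg.invOn.1 hxV
  obtain ⟨ρ, hρ, hdecay⟩ := exists_decay_near_point hK hψ hψ' hk (hg.analytic b hbV)
    (fun v hv0 p hp => by
      obtain ⟨α, hα, hαk, hvα⟩ := hv v hv0
      exact exists_apply_diag_ne_zero (hf.analytic _ (hf.coordProj_mem hxU)) hp hφ hφb hfg hα hαk
        hvα)
  obtain ⟨O, hO, hVO⟩ := hg.relOpen
  have hxO : x₀ ∈ O := (hVO ▸ hxV : x₀ ∈ S ∩ O).2
  obtain ⟨r₁, hr₁, hr₁O⟩ := Metric.nhds_basis_closedBall.mem_iff.mp (hO.mem_nhds hxO)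
  obtain ⟨r₂, hr₂, hr₂V⟩ := Metric.nhds_basis_closedBall.mem_iff.mp (hg.isOpen.mem_nhds hbV)
  set r := min ρ (min r₁ r₂) with hr
  have hr0 : 0 < r := lt_min hρ (lt_min hr₁ hr₂)
  have hrρ : r ≤ ρ := min_le_left _ _
  have hr₁' : r ≤ r₁ := (min_le_right _ _).trans (min_le_left _ _)
  have hr₂' : r ≤ r₂ := (min_le_right _ _).trans (min_le_right _ _)
  set T := S ∩ Metric.closedBall x₀ r with hT
  have hTm : MeasurableSet T := hS.inter measurableSet_closedBall
  have hTV : T ⊆ V := by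
    rw [hVO]
    exact inter_subset_inter_right _ ((Metric.closedBall_subset_closedBall hr₁').trans hr₁O)
  have hVm : MeasurableSet V := by rw [hVO]; exact hS.inter hO.measurableSet
  -- Since the chart is isometric, a ball of the manifold corresponds to a genuine ball of K^d, the
  -- domain of the local estimate.
  have hpre : g ⁻¹' T ∩ V' = Metric.closedBall b r := by
    have hdist : ∀ z ∈ V', dist (g z) x₀ = dist z b := by
      intro z hz
      rw [← hgb, ← hg.isometry _ (hg.toIsAnalyticChart.apply_mem hz) _
        (hg.toIsAnalyticChart.apply_mem hbV), hg.invOn.2 hz, hg.invOn.2 hbV]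
    ext z
    constructor
    · rintro ⟨⟨-, hz⟩, hzV⟩
      rw [Metric.mem_closedBall] at hz ⊢
      rwa [← hdist z hzV]
    · intro hz
      have hzV : z ∈ V' := hr₂V (Metric.closedBall_subset_closedBall hr₂' hz)
      refine ⟨⟨hg.toIsAnalyticChart.subset (hg.toIsAnalyticChart.apply_mem hzV), ?_⟩, hzV⟩
      rw [Metric.mem_closedBall, hdist z hzV]
      exact hz
  have hrestr : (inducedMeasure d S).restrict T =
      (Measure.map g ((haar K d).restrict V')).restrict T := by
    rw [← inducedMeasure_restrict hg hVm, Measure.restrict_restrict hTm,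
      inter_eq_left.mpr hTV]
  have haem : AEMeasurable g ((haar K d).restrict V') :=
    hg.analytic.continuousOn.aemeasurable hg.isOpen.measurableSet
  refine ⟨r, hr0, ?_, ?_⟩
  · rw [← Measure.restrict_apply_self, hrestr, Measure.restrict_apply_self,
      Measure.map_apply_of_aemeasurable haem hTm,
      Measure.restrict_apply' hg.isOpen.measurableSet, hpre]
    exact (isCompact_closedBall b r).measure_lt_top
  · obtain ⟨C, hC⟩ := hdecay r hr0 hrρ
    refine ⟨C, fun y hy => ?_⟩
    rw [hrestr, setIntegral_map hTm (continuous_addChar_dotProduct hψ y).aestronglyMeasurable haem,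
      Measure.restrict_restrict' hg.isOpen.measurableSet, hpre]
    exact hC y hy

/-- Decay of the Fourier transform of the induced measure of a compact manifold which is of type
at most `k` at each point. -/
theorem exists_norm_fourierInduced_le (hK : IsNormalizedNorm K)
    (hψ : ∀ x : K, ‖x‖ < 1 → ψ x = 1) (hψ' : ∃ x : K, ‖x‖ ≤ 1 ∧ ψ x ≠ 1) {k : ℕ}
    (hk : ∀ i : ℕ, 1 ≤ i → i ≤ k → (i : K) ≠ 0) {S : Set (Fin n → K)} (hS : IsCompact S)
    (h : ∀ x ∈ S, HasTypeLEAt d S k x) :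
    ∃ c : ℝ, ∀ y : Fin n → K, y ≠ 0 →
      ‖fourierInduced ψ d S y‖ ≤ c * ‖y‖ ^ (-(1 : ℝ) / k) := by
  have : ProperSpace K := ProperSpace.of_locallyCompactSpace K
  have hloc := fun x : S => (h x.1 x.2).exists_decay hK hψ hψ' hk hS.measurableSet
  choose r hr hfin C hC using hloc
  classical
  obtain ⟨t, htS, hcov, hdisj⟩ := IsCompact.exists_finset_disjoint_closedBall hS
    (fun x => if hx : x ∈ S then r ⟨x, hx⟩ else 1)
    (fun x hx => by rw [dif_pos hx]; exact hr _)
  set μ := inducedMeasure d S with hμ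
  let B : (Fin n → K) → Set (Fin n → K) := fun x =>
    S ∩ Metric.closedBall x (if hx : x ∈ S then r ⟨x, hx⟩ else 1)
  have hBfin : ∀ x ∈ t, μ (B x) < ⊤ := by
    intro x hx
    simp only [B]
    rw [dif_pos (htS x hx)]
    exact hfin ⟨x, htS x hx⟩
  have hSB : S = ⋃ x ∈ t, B x := by
    simp only [B]
    rw [← inter_iUnion₂, inter_eq_left.mpr hcov]
  have hSfin : μ S < ⊤ := by
    rw [hSB]
    exact (measure_biUnion_finset_le t B).trans_lt (ENNReal.sum_lt_top.mpr hBfin)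
  let D : (Fin n → K) → ℝ := fun x => if hx : x ∈ S then C ⟨x, hx⟩ else 0
  have hk0 : -(1 : ℝ) / k ≤ 0 := by rw [neg_div]; exact neg_nonpos.mpr (by positivity)
  -- The sum of the local constants serves for |y| ≥ 1; the total mass serves for |y| < 1, where
  -- |y|^(-1/k) ≥ 1.
  refine ⟨max (∑ x ∈ t, D x) (μ.real S), fun y hy => ?_⟩
  have hy0 : 0 < ‖y‖ := norm_pos_iff.mpr hy
  rw [fourierInduced]
  rcases le_or_gt 1 ‖y‖ with hy1 | hy1
  · have hint : ∫ x in S, (ψ (y ⬝ᵥ x) : ℂ) ∂μ = ∑ x ∈ t, ∫ z in B x, (ψ (y ⬝ᵥ z) : ℂ) ∂μ := by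
      conv_lhs => rw [hSB]
      refine integral_biUnion_finset t (fun x _ => hS.measurableSet.inter measurableSet_closedBall)
        (fun x hx z hz hxz => (hdisj hx hz hxz).mono inter_subset_right inter_subset_right)
        fun x hx => ?_
      refine Measure.integrableOn_of_bounded (M := 1) (hBfin x hx).ne
        (continuous_addChar_dotProduct hψ y).aestronglyMeasurable ?_
      exact Eventually.of_forall fun z => (Circle.norm_coe _).le
    rw [hint]
    calc ‖∑ x ∈ t, ∫ z in B x, (ψ (y ⬝ᵥ z) : ℂ) ∂μ‖
        ≤ ∑ x ∈ t, D x * ‖y‖ ^ (-(1 : ℝ) / k) := by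
          refine norm_sum_le_of_le t fun x hx => ?_
          simp only [B, D]
          rw [dif_pos (htS x hx), dif_pos (htS x hx)]
          exact hC ⟨x, htS x hx⟩ y hy1
      _ = (∑ x ∈ t, D x) * ‖y‖ ^ (-(1 : ℝ) / k) := by rw [Finset.sum_mul]
      _ ≤ _ := by gcongr; exact le_max_left _ _
  · refine (norm_setIntegral_addChar_le hSfin _).trans ?_
    refine (le_max_right (∑ x ∈ t, D x) (μ.real S)).trans ?_
    refine le_mul_of_one_le_right (measureReal_nonneg.trans (le_max_right _ _)) ?_
    exact Real.one_le_rpow_of_pos_of_le_one_of_nonpos hy0 hy1.le hk0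

end Gluing

theorem natCast_ne_zero_of_lt_ringChar {K : Type*} [Field K] {k : ℕ}
    (hk : ringChar K = 0 ∨ k < ringChar K) (i : ℕ) (hi : 1 ≤ i) (hik : i ≤ k) : (i : K) ≠ 0 := by
  rw [Ne, ringChar.spec]
  intro h
  rcases hk with hk | hk
  · rw [hk, zero_dvd_iff] at h; omega
  · exact absurd (Nat.le_of_dvd hi h) (by omega)

end NonarchFourier

/-! ### The theorem -/

theorem theorem3p8 {K : Type*} [NontriviallyNormedField K] [IsUltrametricDist K]
    [LocallyCompactSpace K] [MeasurableSpace K] [BorelSpace K]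
    (hK : IsNormalizedNorm K)
    (ψ : AddChar K Circle) (hψ_triv : ∀ x : K, ‖x‖ < 1 → ψ x = 1)
    (hψ_nontriv : ∃ x : K, ‖x‖ ≤ 1 ∧ ψ x ≠ 1)
    {n d : ℕ} (M : Set (Fin n → K)) (hM : NonarchFourier.IsAnalyticManifold d M)
    (hM_fin : NonarchFourier.IsFiniteType d M)
    (S : Set (Fin n → K)) (hS_compact : IsCompact S)
    (hS_open : ∃ O : Set (Fin n → K), IsOpen O ∧ S = M ∩ O) :
    (∃ k : ℕ, NonarchFourier.IsOfType d S k) ∧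
    ∀ k : ℕ, NonarchFourier.IsOfType d S k → (ringChar K = 0 ∨ k < ringChar K) →
      Tendsto (NonarchFourier.fourierInduced ψ d S) (Bornology.cobounded (Fin n → K)) (𝓝 0) ∧
      ∃ c : ℝ, ∀ y : Fin n → K, y ≠ 0 →
        ‖NonarchFourier.fourierInduced ψ d S y‖ ≤ c * ‖y‖ ^ (-(1 : ℝ) / (k : ℝ)) := by
  refine ⟨NonarchFourier.exists_isOfType hM hM_fin hS_compact hS_open, fun k hk hchar => ?_⟩
  obtain ⟨c, hc⟩ := NonarchFourier.exists_norm_fourierInduced_le hK hψ_triv hψ_nontriv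
    (NonarchFourier.natCast_ne_zero_of_lt_ringChar hchar) hS_compact hk.1.2
  refine ⟨?_, c, hc⟩
  have hk0 : (0 : ℝ) < 1 / k := one_div_pos.mpr (by exact_mod_cast hk.1.1)
  refine squeeze_zero_norm' (a := fun y => c * ‖y‖ ^ (-(1 : ℝ) / (k : ℝ))) ?_ ?_
  · filter_upwards [Bornology.eventually_ne_cobounded (0 : Fin n → K)] with y hy using hc y hy
  · have := ((tendsto_rpow_neg_atTop hk0).comp
      (tendsto_norm_cobounded_atTop (E := Fin n → K))).const_mul c
    simpa [Function.comp_def, neg_div] using this
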